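/- **Theorem 5.** *Setting.* Let $\widehat\Omega\subset\mathbb R^2$ be the union of the elements of a conforming triangulation $\{D^k\}_{k=1}^K$ with mesh size $h=\max_k\operatorname{diam}D^k$, and let $\boldsymbol x=X(\widehat{\boldsymbol x},\tau)$, $\tau\in[0,T]$, $T>0$, $\widehat{\boldsymbol x}=(\xi_1,\xi_2)$, be a mesh motion that is continuous on $\widehat\Omega$ and, on every closed element, of class $C^{N+3}$ in space and time with Jacobian determinant $J_X>0$. Let $$A^j=J_X\begin{pmatrix}\frac{\partial\xi_j}{\partial t}&\frac{\partial\xi_j}{\partial x_1}&\frac{\partial\xi_j}{\partial x_2}\\ \frac{\partial\xi_j}{\partial x_1}&\frac{\partial\xi_j}{\partial t}&0\\ \frac{\partial\xi_j}{\partial x_2}&0&\frac{\partial\xi_j}{\partial t}\end{pmatrix}\ (j=1,2),\qquad A_n=A^1\widehat n_1+A^2\widehat n_2,\qquad d=\sum_j\frac{\partial}{\partial\xi_j}\Big(J_X\frac{\partial\xi_j}{\partial t}\Big),$$ where $\widehat n$ is the outward unit normal of $D^k$. Let $P^N$ be the polynomials of total degree at most $N$. The unknowns on each element are $(\boldsymbol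 qJ)=(pJ,uJ,vJ)\in (P^N)^3$ and $J\in P^N$ with $J>0$ on $D^k$, both differentiable in time. The weight-adjusted (WADG) approximation defines $\boldsymbol q=(p,u,v)\in(P^N)^3$ on $D^k$ as the $L^2(D^k)$ projection of $(\boldsymbol qJ)/J$ (componentwise). They satisfy, for all $k$, all $\tau\in[0,T]$ and all $\boldsymbol w\in(P^N)^3$, $\theta\in P^N$, the skew-symmetric ALE-DG formulation $$\Big(\tfrac{\partial(\boldsymbol qJ)}{\partial\tau},\boldsymbol w\Big)_{D^k}=\sum_{j=1}^2\Big[-\tfrac12\big(\partial_{\xi_j}(A^j\boldsymbol q),\boldsymbol w\big)_{D^k}+\tfrac12\big(\boldsymbol q,\partial_{\xi_j}(A^j\boldsymbol w)\big)_{D^k}-\tfrac12\big((\partial_{\xi_j}A^j)\boldsymbol q,\boldsymbol w\big)_{D^k}\Big]-\tfrac12\langle\boldsymbol q^*,A_n\boldsymbol w\rangle_{\partial D^k},$$ $$\Big(\tfrac{\partial J}{\partial\tau},\theta\Big)_{D^k}=-(d,\theta)_{D^k},$$ with the penalty flux $\boldsymbol q^*=\boldsymbol q^+-\tau_qA_n[\![\boldsymbol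 q]\!]$, $[\![\boldsymbol q]\!]=\boldsymbol q^+-\boldsymbol q$, $\tau_q\ge0$, where $\boldsymbol q^+$ is the trace from the neighboring element on interior faces and $\boldsymbol q^+=0$ on $\partial\widehat\Omega$ (homogeneous Dirichlet condition). *Claim.* For every $N\ge0$ and all reals $J_{\min}>0$, $J_{\max}$, $G$, $R$ there is a constant $C\ge 0$, depending only on $N,J_{\min},J_{\max},G,R$, such that for every triangulation, motion, $T>0$, $\tau_q\ge0$ and solution as above for which, at all times in $[0,T]$: $J\ge J_{\min}$ and all space derivatives of order at most $N+1$ of $J$ and of $d$ are bounded by $J_{\max}$ and by $G$, respectively, on every element; and $\sum_k\|\boldsymbol q\|^2_{H^{N+1}(D^k)}\le R^2$; the energy is differentiable in time on $[0,T]$ and, at every time of $[0,T]$, $$\frac12\frac{\partial}{\partial\tau}\Big(\|pJ\|^2_{1/J}+\|uJ\|^2_{1/J}+\|vJ\|^2_{1/J}\Big)\le C\,h^{2N+2}-\frac{\tau_q}{2}\sum_F\int_F[\![\boldsymbol q]\!]^TA_n^TA_n[\![\boldsymbol q]\!],$$ where $\|f\|_{1/J}^2=\sum_k\int_{D^k}f^2/J$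 and $F$ runs over all faces of the triangulation, interior and boundary, each counted once. -/

import Mathlib

open scoped Matrix ContDiff

noncomputable section

namespace ALEDG

/-- The plane containing the reference domain, with its Euclidean norm. -/
abbrev Plane := EuclideanSpace ℝ (Fin 2)

/-- Partial derivative with respect to the `j`-th coordinate. -/
def pderiv (j : Fin 2) (f : Plane → ℝ) (x : Plane) : ℝ :=
  fderiv ℝ f x (EuclideanSpace.single j 1)

/-- Polynomial functions of total degree at most `N` in two variables. This space is invariant
under affine changes of variables, so on a triangle `D` it is the image of the polynomials of
degree at most `N` on the reference triangle. A polynomial on a triangle is identified with its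
unique polynomial extension to the plane. -/
def IsPoly (N : ℕ) (f : Plane → ℝ) : Prop :=
  ∃ P : MvPolynomial (Fin 2) ℝ, P.totalDegree ≤ N ∧ ∀ x, f x = MvPolynomial.eval (fun i => x i) P

/-! ### Triangulations -/

/-- A (conforming) triangulation with `K` triangular elements: distinct elements meet in the
empty set, in a common vertex, or in a common edge. -/
structure TriMesh (K : ℕ) where
  vert : Fin K → Fin 3 → Plane
  indep : ∀ k, AffineIndependent ℝ (vert k)
  inj : ∀ k l, Set.range (vert k) = Set.range (vert l) → k = l
  inter : ∀ k l,
    convexHull ℝ (Set.range (vert k)) ∩ convexHull ℝ (Set.range (vert l)) ⊆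
      convexHull ℝ (Set.range (vert k) ∩ Set.range (vert l))

namespace TriMesh

variable {K : ℕ} (M : TriMesh K)

/-- The closed triangle `D^k`. -/
def elem (k : Fin K) : Set Plane := convexHull ℝ (Set.range (M.vert k))

/-- The mesh size: the largest diameter of an element. -/
def meshSize : ℝ := ⨆ k, Metric.diam (M.elem k)

/-- The edge `i` of the triangle `k` is the one opposite to the vertex `i`; it runs from
`edgeStart` to `edgeEnd`. -/
def edgeStart (k : Fin K) (i : Fin 3) : Plane := M.vert k (i + 1)

/-- The second end point of the edge `i` of the triangle `k`. -/
def edgeEnd (k : Fin K) (i : Fin 3) : Plane := M.vert k (i + 2)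

/-- The integral, with respect to arc length, of `g` over the edge `i` of the triangle `k`. -/
def edgeIntegral (k : Fin K) (i : Fin 3) (g : Plane → ℝ) : ℝ :=
  dist (M.edgeStart k i) (M.edgeEnd k i) *
    ∫ s in (0 : ℝ)..1, g (AffineMap.lineMap (M.edgeStart k i) (M.edgeEnd k i) s)

/-- Outward unit normal of the triangle `k` on its edge `i`: the edge vector turned by a right
angle, normalized, and directed away from the opposite vertex. -/
def normal (k : Fin K) (i : Fin 3) : Fin 2 → ℝ :=
  let a := M.edgeStart k i
  let b := M.edgeEnd k i
  let c := M.vert k i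
  let ν : Fin 2 → ℝ := ![b 1 - a 1, -(b 0 - a 0)]
  (-(Real.sign (ν 0 * (c 0 - a 0) + ν 1 * (c 1 - a 1))) / dist a b) • ν

/-- The triangle `l` is the neighbor of the triangle `k` across the edge `i` of `k`: it is another
element that has both end points of this edge among its vertices. There is at most one. -/
def IsNeighbor (k : Fin K) (i : Fin 3) (l : Fin K) : Prop :=
  l ≠ k ∧ ∀ j, j ≠ i → M.vert k j ∈ Set.range (M.vert l)

/-- The edge `i` of the triangle `k` is interior (otherwise it lies on the boundary). -/
def IsInterior (k : Fin K) (i : Fin 3) : Prop := ∃ l, M.IsNeighbor k i l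

open Classical in
/-- The exterior trace `q⁺` on the edge `i` of the triangle `k`: the value from the neighboring
element across an interior edge, and `0` on a boundary edge (homogeneous Dirichlet condition). -/
def extTrace (q : Fin K → Plane → Fin 3 → ℝ) (k : Fin K) (i : Fin 3) (x : Plane) : Fin 3 → ℝ :=
  if h : M.IsInterior k i then q h.choose x else 0

/-- The jump `⟦q⟧ = q⁺ - q` on the edge `i` of the triangle `k`. -/
def jump (q : Fin K → Plane → Fin 3 → ℝ) (k : Fin K) (i : Fin 3) (x : Plane) : Fin 3 → ℝ :=
  M.extTrace q k i x - q k x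

end TriMesh

/-! ### Geometric factors of a mesh motion `x = X(ξ, τ)` (on one element) -/

/-- The spatial Jacobian matrix `∂x_i / ∂ξ_j`. -/
def jacMatrix (X : ℝ → Plane → Plane) (t : ℝ) (x : Plane) : Matrix (Fin 2) (Fin 2) ℝ :=
  Matrix.of fun i j => pderiv j (fun y => X t y i) x

/-- The Jacobian determinant of the transformation. -/
def jacDet (X : ℝ → Plane → Plane) (t : ℝ) (x : Plane) : ℝ := (jacMatrix X t x).det

/-- `∂ξ_j / ∂x_i`: entry of the inverse of the Jacobian matrix. -/
def dxidx (X : ℝ → Plane → Plane) (j i : Fin 2) (t : ℝ) (x : Plane) : ℝ :=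
  (jacMatrix X t x)⁻¹ j i

/-- `∂ξ_j / ∂t = - ∑ i, (∂ξ_j / ∂x_i) (∂x_i / ∂τ)`: the time derivative of the inverse mapping, by
differentiating `ξ(X(ξ, τ), τ) = ξ` with respect to `τ`. -/
def dxidt (X : ℝ → Plane → Plane) (j : Fin 2) (t : ℝ) (x : Plane) : ℝ :=
  -∑ i, dxidx X j i t x * deriv (fun s => X s x i) t

/-- The matrix `A^j` of the acoustic wave equation on the reference domain. -/
def matA (X : ℝ → Plane → Plane) (j : Fin 2) (t : ℝ) (x : Plane) : Matrix (Fin 3) (Fin 3) ℝ :=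
  let J := jacDet X t x
  !![dxidt X j t x * J,   dxidx X j 0 t x * J, dxidx X j 1 t x * J;
     dxidx X j 0 t x * J, dxidt X j t x * J,   0;
     dxidx X j 1 t x * J, 0,                   dxidt X j t x * J]

/-- The entrywise derivative `∂A^j / ∂ξ_j`. -/
def dmatA (X : ℝ → Plane → Plane) (j : Fin 2) (t : ℝ) (x : Plane) : Matrix (Fin 3) (Fin 3) ℝ :=
  Matrix.of fun a b => pderiv j (fun y => matA X j t y a b) x

/-- `∇̂ · (J x̂_t)` with `x̂_t = (∂ξ_1/∂t, ∂ξ_2/∂t)`. -/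
def geomDiv (X : ℝ → Plane → Plane) (t : ℝ) (x : Plane) : ℝ :=
  ∑ j, pderiv j (fun y => jacDet X t y * dxidt X j t y) x

/-- `A_n = A^1 n_1 + A^2 n_2`. -/
def matAn (X : ℝ → Plane → Plane) (n : Fin 2 → ℝ) (t : ℝ) (x : Plane) :
    Matrix (Fin 3) (Fin 3) ℝ :=
  ∑ j, n j • matA X j t x

/-- A motion of the mesh `M` on the time interval `[0, T]`: on every element it is of class `C^m`
in space and time up to the boundary (given through an extension), with positive Jacobian, and it
is continuous across element interfaces. -/
structure IsMeshMotion {K : ℕ} (M : TriMesh K) (T : ℝ) (m : ℕ)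
    (X : Fin K → ℝ → Plane → Plane) : Prop where
  smooth : ∀ k, ContDiff ℝ m (fun z : ℝ × Plane => X k z.1 z.2)
  compat : ∀ k l, ∀ t ∈ Set.Icc 0 T, ∀ x ∈ M.elem k ∩ M.elem l, X k t x = X l t x
  det_pos : ∀ k, ∀ t ∈ Set.Icc 0 T, ∀ x ∈ M.elem k, 0 < jacDet (X k) t x

/-! ### The semi-discrete scheme -/

section scheme

variable {K : ℕ} (M : TriMesh K)

/-- The penalty flux `q* = q⁺ - τ_q A_n ⟦q⟧` on the edge `i` of the triangle `k`. -/
def flux (τ : ℝ) (X : Fin K → ℝ → Plane → Plane) (t : ℝ) (q : Fin K → Plane → Fin 3 → ℝ)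
    (k : Fin K) (i : Fin 3) (x : Plane) : Fin 3 → ℝ :=
  M.extTrace q k i x - τ • (matAn (X k) (M.normal k i) t x *ᵥ M.jump q k i x)

/-- The right-hand side of the skew-symmetric formulation on the triangle `k` at time `t`, with
discrete solution `q` and test function `w`. -/
def schemeRHS (τ : ℝ) (X : Fin K → ℝ → Plane → Plane) (t : ℝ) (q : Fin K → Plane → Fin 3 → ℝ)
    (k : Fin K) (w : Plane → Fin 3 → ℝ) : ℝ :=
  (∑ j : Fin 2,
    (-(1 / 2) * (∫ x in M.elem k,
        (fun c => pderiv j (fun y => (matA (X k) j t y *ᵥ q k y) c) x) ⬝ᵥ w x)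
      + (1 / 2) * (∫ x in M.elem k,
        q k x ⬝ᵥ (fun c => pderiv j (fun y => (matA (X k) j t y *ᵥ w y) c) x))
      - (1 / 2) * (∫ x in M.elem k, (dmatA (X k) j t x *ᵥ q k x) ⬝ᵥ w x)))
  - (1 / 2) * ∑ i : Fin 3, M.edgeIntegral k i fun x =>
      flux M τ X t q k i x ⬝ᵥ (matAn (X k) (M.normal k i) t x *ᵥ w x)

/-- Solutions on `[0, T]` of the semi-discrete skew-symmetric ALE-DG formulation of degree `N` with
penalty flux and weight-adjusted mass matrices. On the element `k`, at time `t`, the evolved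
variables are `qJ k t = (pJ, uJ, vJ)` and `J k t`, and `q k t = (p, u, v)` is the `L²` projection of
`qJ / J`. -/
structure IsWADGSolution (N : ℕ) (T τ : ℝ) (X : Fin K → ℝ → Plane → Plane)
    (J : Fin K → ℝ → Plane → ℝ) (qJ q : Fin K → ℝ → Plane → Fin 3 → ℝ) : Prop where
  J_poly : ∀ k, ∀ t ∈ Set.Icc 0 T, IsPoly N (J k t)
  qJ_poly : ∀ k, ∀ t ∈ Set.Icc 0 T, ∀ c, IsPoly N (fun x => qJ k t x c)
  q_poly : ∀ k, ∀ t ∈ Set.Icc 0 T, ∀ c, IsPoly N (fun x => q k t x c)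
  J_diff : ∀ k x, DifferentiableOn ℝ (fun t => J k t x) (Set.Icc 0 T)
  qJ_diff : ∀ k x c, DifferentiableOn ℝ (fun t => qJ k t x c) (Set.Icc 0 T)
  J_pos : ∀ k, ∀ t ∈ Set.Icc 0 T, ∀ x ∈ M.elem k, 0 < J k t x
  wadg : ∀ k, ∀ t ∈ Set.Icc 0 T, ∀ c, ∀ v, IsPoly N v →
    ∫ x in M.elem k, q k t x c * v x = ∫ x in M.elem k, qJ k t x c / J k t x * v x
  wave : ∀ k, ∀ t ∈ Set.Icc 0 T, ∀ w : Plane → Fin 3 → ℝ, (∀ c, IsPoly N (fun x => w x c)) →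
    ∫ x in M.elem k, (fun c => derivWithin (fun s => qJ k s x c) (Set.Icc 0 T) t) ⬝ᵥ w x =
      schemeRHS M τ X t (fun l => q l t) k w
  gcl : ∀ k, ∀ t ∈ Set.Icc 0 T, ∀ θ, IsPoly N θ →
    ∫ x in M.elem k, derivWithin (fun s => J k s x) (Set.Icc 0 T) t * θ x =
      -∫ x in M.elem k, geomDiv (X k) t x * θ x

/-- The energy `½ (‖pJ‖²_{1/J} + ‖uJ‖²_{1/J} + ‖vJ‖²_{1/J})` at a fixed time. -/
def energy (J : Fin K → Plane → ℝ) (qJ : Fin K → Plane → Fin 3 → ℝ) : ℝ :=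
  (1 / 2) * ∑ c : Fin 3, ∑ k, ∫ x in M.elem k, qJ k x c / J k x * qJ k x c

open Classical in
/-- The sum over all faces `F` of the mesh of `∫_F ⟦q⟧ᵀ A_nᵀ A_n ⟦q⟧`. An interior face is an edge
of two elements, which contribute equally, hence the weight `1/2`. -/
def jumpTerm (X : Fin K → ℝ → Plane → Plane) (t : ℝ) (q : Fin K → Plane → Fin 3 → ℝ) : ℝ :=
  ∑ k, ∑ i : Fin 3, (if M.IsInterior k i then (1 / 2 : ℝ) else 1) *
    M.edgeIntegral k i fun x =>
      M.jump q k i x ⬝ᵥ (((matAn (X k) (M.normal k i) t x)ᵀ * matAn (X k) (M.normal k i) t x) *ᵥ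
        M.jump q k i x)

/-- The square of the broken Sobolev norm of order `m` (the sum over all elements and components of
the squared `L²` norms of the derivatives of order at most `m`) of an elementwise smooth
function. -/
def brokenSobolevSq (m : ℕ) (q : Fin K → Plane → Fin 3 → ℝ) : ℝ :=
  ∑ k, ∑ c : Fin 3, ∑ r ∈ Finset.range (m + 1),
    ∫ x in M.elem k, ‖iteratedFDeriv ℝ r (fun y => q k y c) x‖ ^ 2

/-- All derivatives of order at most `m` of the elementwise smooth function `f` are bounded by `B`
on every element. -/
def DerivBound (m : ℕ) (B : ℝ) (f : Fin K → Plane → ℝ) : Prop :=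
  ∀ k, ∀ x ∈ M.elem k, ∀ r ≤ m, ‖iteratedFDeriv ℝ r (f k) x‖ ≤ B

end scheme

end ALEDG

end

/-! Fix one component and write `y = qJ / J`, `e = -∂J/∂τ`, and `d` for the geometric divergence.
The rate of change of the integral of `y² J` is the integral of `2 y (qJ)' - y² J'`. Since `(qJ)'`
is again a polynomial of degree at most `N`, the projection property replaces `y` by `q` in the
first term, and the scheme may be tested with `w = q`. The first two volume terms then cancel by
skew-symmetry. The metric identities (`sum_dmatA`) turn the third into `-½ ∫ d |q|²`, and the fluxes
sum over the faces to exactly the penalty term (`sum_flux`). What remains is the consistency error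
`∫ (y² e - d q²)`, which would vanish if the two projections were exact.

That error is quadratic in small quantities. With `z = y - q` and `w = e - d`, `y² e - d q² = z² e +
2 z q w + 2 z q d + q² w`. Both `z` and `w` are orthogonal to `P^N`, the latter because the discrete
conservation law makes `e` the projection of `d`. Hence polynomial approximations of `q d` and `q²`
may be subtracted in the last two terms, and each of the four terms becomes a product of two factors
of size `h^(N+1)`, up to the bounded factors `e` and `q`. This is `exists_element_estimate`. The
size of `z` comes from approximating `q J` by a polynomial (`integral_weightAdjusted_sq_le`), that
of `w` from approximating `d`.

No shape regularity enters. Approximation is by Taylor polynomials, which needs only convexity and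
the diameter (`exists_isPoly_approx`). The inverse estimate compares the maximum norm with the mean
square, and this comparison is affine invariant (`exists_inverse_estimate`). Applied to the
derivatives of `q` it bounds them by the Sobolev norm divided by the square root of the area; the
area cancels on integration, so the element errors add up to the broken Sobolev norm.

Flux cancellation needs opposite normal matrices on a shared edge: they involve only the mesh
velocity and tangential derivatives, which agree there because the motion is continuous
(`cofactorMatAn_neighbor`). Conformity gives uniqueness of the neighbor (`SameEdge.unique`).
Differentiability of the energy uses that polynomials of bounded degree form a finite-dimensional
space, so pointwise convergence of difference quotients already bounds them uniformly on an element.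
-/

namespace ALEDG

open MeasureTheory Set Filter Topology

/-! ### Polynomial functions on the plane -/

namespace IsPoly

variable {m n : ℕ} {f g : Plane → ℝ}

theorem mono (h : IsPoly m f) (hmn : m ≤ n) : IsPoly n f := by
  obtain ⟨P, hP, hf⟩ := h
  exact ⟨P, hP.trans hmn, hf⟩

theorem const (n : ℕ) (a : ℝ) : IsPoly n fun _ => a :=
  ⟨MvPolynomial.C a, by simp, by simp⟩

theorem coord (i : Fin 2) : IsPoly 1 fun x => x i :=
  ⟨MvPolynomial.X i, by simp, by simp⟩

theorem add (hf : IsPoly n f) (hg : IsPoly n g) : IsPoly n fun x => f x + g x := by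
  obtain ⟨P, hP, hf⟩ := hf
  obtain ⟨Q, hQ, hg⟩ := hg
  exact ⟨P + Q, (MvPolynomial.totalDegree_add _ _).trans (max_le hP hQ), by simp [hf, hg]⟩

theorem mul (hf : IsPoly m f) (hg : IsPoly n g) : IsPoly (m + n) fun x => f x * g x := by
  obtain ⟨P, hP, hf⟩ := hf
  obtain ⟨Q, hQ, hg⟩ := hg
  exact ⟨P * Q, (MvPolynomial.totalDegree_mul _ _).trans (add_le_add hP hQ), by simp [hf, hg]⟩

theorem const_mul (a : ℝ) (hf : IsPoly n f) : IsPoly n fun x => a * f x :=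
  ((const 0 a).mul hf).mono (by simp)

theorem neg (hf : IsPoly n f) : IsPoly n fun x => -f x := by
  simpa using hf.const_mul (-1)

theorem sub (hf : IsPoly n f) (hg : IsPoly n g) : IsPoly n fun x => f x - g x := by
  simpa [sub_eq_add_neg] using hf.add hg.neg

theorem sum {ι : Type*} (s : Finset ι) {F : ι → Plane → ℝ} (h : ∀ i ∈ s, IsPoly n (F i)) :
    IsPoly n fun x => ∑ i ∈ s, F i x := by
  classical
  induction s using Finset.induction_on with
  | empty => simpa using const n 0
  | insert a s ha ih =>
    simp only [Finset.sum_insert ha]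
    exact (h a (by simp)).add (ih fun i hi => h i (by simp [hi]))

theorem pow (hf : IsPoly m f) (k : ℕ) : IsPoly (m * k) fun x => f x ^ k := by
  obtain ⟨P, hP, hf⟩ := hf
  refine ⟨P ^ k, (MvPolynomial.totalDegree_pow _ _).trans ?_, by simp [hf]⟩
  rw [mul_comm m]
  exact Nat.mul_le_mul_left _ hP

end IsPoly

/-- The monomial functions of degree at most `n`. -/
def monomials (n : ℕ) : Set (Plane → ℝ) :=
  (fun (p : ℕ × ℕ) (x : Plane) => x 0 ^ p.1 * x 1 ^ p.2) '' {p | p.1 + p.2 ≤ n}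

theorem IsPoly.of_monomial {n : ℕ} {f : Plane → ℝ} (hf : f ∈ monomials n) : IsPoly n f := by
  obtain ⟨⟨a, b⟩, hab, rfl⟩ := hf
  exact (((IsPoly.coord 0).pow a).mul ((IsPoly.coord 1).pow b)).mono (by simpa using hab)

/-- The space of polynomial functions of degree at most `n`. -/
def polySpace (n : ℕ) : Submodule ℝ (Plane → ℝ) where
  carrier := {f | IsPoly n f}
  add_mem' := IsPoly.add
  zero_mem' := IsPoly.const n 0
  smul_mem' a _ hf := hf.const_mul a

theorem polySpace_eq_span (n : ℕ) : polySpace n = Submodule.span ℝ (monomials n) := by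
  apply le_antisymm
  · rintro f ⟨P, hP, hf⟩
    have : f = ∑ s ∈ P.support, P.coeff s • fun x : Plane => x 0 ^ s 0 * x 1 ^ s 1 := by
      ext x
      simp [hf, MvPolynomial.eval_eq', Fin.prod_univ_two]
    rw [this]
    refine Submodule.sum_mem _ fun s hs => Submodule.smul_mem _ _ (Submodule.subset_span ?_)
    refine ⟨(s 0, s 1), ?_, rfl⟩
    have := (MvPolynomial.le_totalDegree hs).trans hP
    simpa [Finsupp.sum_fintype] using this
  · rw [Submodule.span_le]
    exact fun f hf => IsPoly.of_monomial hf

theorem finite_monomials (n : ℕ) : (monomials n).Finite := by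
  refine Set.Finite.image _ ((finite_Iic ((n, n) : ℕ × ℕ)).subset ?_)
  rintro ⟨a, b⟩ h
  simp only [mem_ofPred_eq] at h
  exact ⟨by simp; omega, by simp; omega⟩

instance (n : ℕ) : FiniteDimensional ℝ (polySpace n) := by
  rw [polySpace_eq_span]
  exact FiniteDimensional.span_of_finite ℝ (finite_monomials n)

theorem IsPoly.induction {n : ℕ} {p : (Plane → ℝ) → Prop}
    (mon : ∀ a b : ℕ, a + b ≤ n → p fun x => x 0 ^ a * x 1 ^ b)
    (zero : p fun _ => 0) (add : ∀ f g, IsPoly n f → IsPoly n g → p f → p g → p fun x => f x + g x)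
    (smul : ∀ (a : ℝ) f, IsPoly n f → p f → p fun x => a * f x) {f : Plane → ℝ}
    (hf : IsPoly n f) : p f := by
  have hf' : f ∈ Submodule.span ℝ (monomials n) := by
    rw [← polySpace_eq_span]; exact hf
  have key : ∀ g, g ∈ Submodule.span ℝ (monomials n) → IsPoly n g := fun g hg => by
    rw [← polySpace_eq_span] at hg; exact hg
  clear hf
  induction hf' using Submodule.span_induction with
  | mem f h =>
    obtain ⟨⟨a, b⟩, hab, rfl⟩ := h
    exact mon a b hab
  | zero => exact zero
  | add f g hf hg ihf ihg => exact add f g (key f hf) (key g hg) ihf ihg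
  | smul a f hf ih => exact smul a f (key f hf) ih

theorem contDiff_coord (i : Fin 2) {k : ℕ∞ω} : ContDiff ℝ k fun x : Plane => x i :=
  (EuclideanSpace.proj (𝕜 := ℝ) i).contDiff

theorem IsPoly.contDiff {n : ℕ} {f : Plane → ℝ} (hf : IsPoly n f) {k : ℕ∞ω} :
    ContDiff ℝ k f := by
  refine IsPoly.induction (p := fun f => ContDiff ℝ k f) ?_ ?_ ?_ ?_ hf
  · intro a b _
    exact ((contDiff_coord 0).pow a).mul ((contDiff_coord 1).pow b)
  · exact contDiff_const
  · exact fun f g _ _ hf hg => hf.add hg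
  · exact fun a f _ hf => contDiff_const.mul hf

theorem IsPoly.continuous {n : ℕ} {f : Plane → ℝ} (hf : IsPoly n f) : Continuous f :=
  (hf.contDiff (k := 0)).continuous

theorem IsPoly.differentiable {n : ℕ} {f : Plane → ℝ} (hf : IsPoly n f) : Differentiable ℝ f :=
  (hf.contDiff (k := 1)).differentiable (by simp)

theorem hasFDerivAt_coord (i : Fin 2) (x : Plane) :
    HasFDerivAt (fun x : Plane => x i) (EuclideanSpace.proj (𝕜 := ℝ) i) x :=
  (EuclideanSpace.proj (𝕜 := ℝ) i).hasFDerivAt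

theorem IsPoly.fderiv_apply {n : ℕ} {f : Plane → ℝ} (hf : IsPoly n f) (v : Plane) :
    IsPoly n fun x => fderiv ℝ f x v := by
  refine IsPoly.induction (p := fun f => IsPoly n fun x => fderiv ℝ f x v) ?_ ?_ ?_ ?_ hf
  · intro a b hab
    have h : ∀ x : Plane, fderiv ℝ (fun x : Plane => x 0 ^ a * x 1 ^ b) x v =
        v 1 * b * (x 0 ^ a * x 1 ^ (b - 1)) + v 0 * a * (x 0 ^ (a - 1) * x 1 ^ b) := by
      intro x
      rw [HasFDerivAt.fderiv (HasFDerivAt.fun_mul (HasFDerivAt.pow (hasFDerivAt_coord 0 x) a)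
        (HasFDerivAt.pow (hasFDerivAt_coord 1 x) b))]
      simp
      ring
    simp only [h]
    refine (const_mul _ (of_monomial ⟨(a, b - 1), ?_, rfl⟩)).add
      (const_mul _ (of_monomial ⟨(a - 1, b), ?_, rfl⟩)) <;> simp <;> omega
  · simpa using const n 0
  · intro f g hf hg h1 h2
    have h : ∀ x : Plane, fderiv ℝ (fun x => f x + g x) x v = fderiv ℝ f x v + fderiv ℝ g x v := by
      intro x
      rw [fderiv_fun_add hf.differentiable.differentiableAt hg.differentiable.differentiableAt]
      rfl
    simpa only [h] using h1.add h2
  · intro a f hf h1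
    have h : ∀ x : Plane, fderiv ℝ (fun x => a * f x) x v = a * fderiv ℝ f x v := by
      intro x
      rw [fderiv_const_mul hf.differentiable.differentiableAt]
      rfl
    simpa only [h] using h1.const_mul a

/-- Evaluating on fixed vectors makes the derivatives scalar polynomials, to which the inverse
estimate applies. -/
theorem IsPoly.iteratedFDeriv_apply {n : ℕ} {f : Plane → ℝ} (hf : IsPoly n f) (r : ℕ) :
    ∀ m : Fin r → Plane, IsPoly n fun x => iteratedFDeriv ℝ r f x m := by
  induction r with
  | zero => intro m; simpa using hf
  | succ r ih =>
    intro m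
    convert (ih (Fin.tail m)).fderiv_apply (m 0) using 2 with x
    rw [iteratedFDeriv_succ_apply_left]
    have hd : DifferentiableAt ℝ (iteratedFDeriv ℝ r f) x :=
      ((hf.contDiff (k := ∞)).differentiable_iteratedFDeriv (by
        exact_mod_cast WithTop.coe_lt_top r)).differentiableAt
    rw [fderiv_continuousMultilinear_apply_const_apply hd]

/-- Polynomials of degree at most `n` are invariant under affine changes of variables. -/
theorem IsPoly.comp_affine {n : ℕ} {f : Plane → ℝ} (hf : IsPoly n f) {Φ : Plane → Plane}
    (hΦ : ∀ i, IsPoly 1 fun x => Φ x i) : IsPoly n fun x => f (Φ x) := by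
  refine IsPoly.induction (p := fun f => IsPoly n fun x => f (Φ x)) ?_ ?_ ?_ ?_ hf
  · intro a b hab
    exact (((hΦ 0).pow a).mul ((hΦ 1).pow b)).mono (by simpa using hab)
  · exact const n 0
  · exact fun f g _ _ hf hg => hf.add hg
  · exact fun a f _ hf => hf.const_mul a

theorem isPoly_linear (L : Plane →L[ℝ] ℝ) : IsPoly 1 fun x => L x := by
  have h : ∀ x : Plane, L x = L (EuclideanSpace.single 0 1) * x 0 +
      L (EuclideanSpace.single 1 1) * x 1 := by
    intro x
    have : x = x 0 • EuclideanSpace.single 0 (1 : ℝ) + x 1 • EuclideanSpace.single 1 (1 : ℝ) := by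
      ext i; fin_cases i <;> simp
    conv_lhs => rw [this]
    rw [map_add, map_smul, map_smul, smul_eq_mul, smul_eq_mul]
    ring
  rw [funext h]
  exact ((IsPoly.coord 0).const_mul _).add ((IsPoly.coord 1).const_mul _)

/-- The homogeneous polynomial associated with a multilinear map. -/
theorem isPoly_multilinear {i : ℕ} (L : Plane [×i]→L[ℝ] ℝ) (x₀ : Plane) :
    IsPoly i fun x => L fun _ => x - x₀ := by
  induction i with
  | zero =>
    have : (fun x => L fun _ => x - x₀) = fun _ => L ![] := by
      ext x; congr 1; exact Subsingleton.elim _ _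
    rw [this]
    exact IsPoly.const 0 _
  | succ i ih =>
    have h : ∀ x : Plane, (L fun _ => x - x₀) =
        (x 0 - x₀ 0) * (L.curryLeft (EuclideanSpace.single 0 1) fun _ => x - x₀) +
        (x 1 - x₀ 1) * (L.curryLeft (EuclideanSpace.single 1 1) fun _ => x - x₀) := by
      intro x
      have h1 : (L fun _ => x - x₀) = L.curryLeft (x - x₀) fun _ => x - x₀ := by
        rw [ContinuousMultilinearMap.curryLeft_apply]
        congr 1
        ext j
        refine Fin.cases ?_ (fun j => ?_) j <;> simp
      have h2 : x - x₀ = (x 0 - x₀ 0) • EuclideanSpace.single 0 (1 : ℝ) +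
          (x 1 - x₀ 1) • EuclideanSpace.single 1 (1 : ℝ) := by
        ext i; fin_cases i <;> simp
      rw [h1]
      conv_lhs => rw [congrArg L.curryLeft h2]
      simp
    simp only [h]
    have hc : ∀ j : Fin 2, IsPoly 1 fun x : Plane => x j - x₀ j := fun j =>
      (IsPoly.coord j).sub (IsPoly.const 1 _)
    exact (((hc 0).mul (ih _)).mono (by omega)).add (((hc 1).mul (ih _)).mono (by omega))

/-! ### Pointwise limits of polynomials -/

/-- Pointwise convergence is convergence in the product topology, where a finite-dimensional
subspace is closed. -/
theorem IsPoly.of_tendsto {α : Type*} {l : Filter α} [l.NeBot] {n : ℕ} {F : α → Plane → ℝ}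
    {g : Plane → ℝ} (hF : ∀ᶠ a in l, IsPoly n (F a))
    (h : ∀ x, Tendsto (fun a => F a x) l (𝓝 (g x))) : IsPoly n g := by
  have hc : IsClosed (polySpace n : Set (Plane → ℝ)) := Submodule.closed_of_finiteDimensional _
  exact hc.mem_of_tendsto (tendsto_pi_nhds.mpr h) hF

/-- A pointwise convergent family of polynomials of bounded degree is uniformly bounded on
compact sets. -/
theorem IsPoly.eventually_bounded {α : Type*} {l : Filter α} [l.NeBot] {n : ℕ}
    {F : α → Plane → ℝ} {g : Plane → ℝ} (hF : ∀ᶠ a in l, IsPoly n (F a))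
    (h : ∀ x, Tendsto (fun a => F a x) l (𝓝 (g x))) {D : Set Plane} (hD : IsCompact D) :
    ∃ B, ∀ᶠ a in l, ∀ x ∈ D, |F a x| ≤ B := by
  classical
  have hg : IsPoly n g := IsPoly.of_tendsto hF h
  have : CompactSpace D := isCompact_iff_compactSpace.mp hD
  -- Restriction to `D` is linear on a finite-dimensional space, hence continuous from the topology
  -- of pointwise convergence to the uniform norm.
  let Λ : polySpace n →ₗ[ℝ] C(D, ℝ) :=
    { toFun := fun f => ⟨fun x => f.1 x, (IsPoly.continuous f.2).comp continuous_subtype_val⟩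
      map_add' := fun f g => rfl
      map_smul' := fun a f => rfl }
  have hΛ : Continuous Λ := Λ.continuous_of_finiteDimensional
  let F' : α → polySpace n := fun a => if ha : IsPoly n (F a) then ⟨F a, ha⟩ else 0
  have hF' : ∀ᶠ a in l, (F' a : Plane → ℝ) = F a := by
    filter_upwards [hF] with a ha
    simp [F', ha]
  have ht : Tendsto F' l (𝓝 ⟨g, hg⟩) := by
    rw [tendsto_subtype_rng]
    exact (tendsto_pi_nhds.mpr h).congr' (hF'.mono fun a ha => ha.symm)
  have hb := ((hΛ.tendsto _).comp ht).norm
  refine ⟨‖Λ ⟨g, hg⟩‖ + 1, ?_⟩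
  filter_upwards [hb.eventually_le_const (lt_add_one _), hF'] with a ha hFa x hx
  have := (ContinuousMap.norm_coe_le_norm (Λ (F' a)) ⟨x, hx⟩).trans ha
  simpa [Λ, hFa] using this

/-! ### Taylor approximation on convex sets -/

/-- The family `φ` plays the role of a function and its successive derivatives. The derivative of
the remainder is the remainder of the shifted family, so the mean value inequality on the unit
interval propagates the bound `B`; the factor `1 / m!` is given up. -/
theorem abs_sub_taylor_le {B : ℝ} (m : ℕ) : ∀ φ : ℕ → ℝ → ℝ,
    (∀ i < m, ∀ s ∈ Icc (0 : ℝ) 1, HasDerivWithinAt (φ i) (φ (i + 1) s) (Icc 0 1) s) →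
    (∀ s ∈ Icc (0 : ℝ) 1, |φ m s| ≤ B) →
    ∀ s ∈ Icc (0 : ℝ) 1,
      |φ 0 s - ∑ i ∈ Finset.range m, φ i 0 * (s ^ i / (i.factorial : ℝ))| ≤ B := by
  induction m with
  | zero => intro φ _ hB s hs; simpa using hB s hs
  | succ m ih =>
    intro φ hd hB s hs
    have h1 := ih (fun i => φ (i + 1)) (fun i hi s hs => hd (i + 1) (by omega) s hs) hB
    have hder : ∀ s ∈ Icc (0 : ℝ) 1, HasDerivWithinAt
        (fun s => φ 0 s - ∑ i ∈ Finset.range (m + 1), φ i 0 * (s ^ i / (i.factorial : ℝ)))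
        (φ 1 s - ∑ i ∈ Finset.range m, φ (i + 1) 0 * (s ^ i / (i.factorial : ℝ)))
        (Icc 0 1) s := by
      intro s hs
      refine (hd 0 (by omega) s hs).sub ?_
      have h2 : HasDerivWithinAt
          (fun s : ℝ => ∑ i ∈ Finset.range (m + 1), φ i 0 * (s ^ i / (i.factorial : ℝ)))
          (∑ i ∈ Finset.range (m + 1), φ i 0 * (i * s ^ (i - 1) / (i.factorial : ℝ)))
          (Icc 0 1) s :=
        HasDerivWithinAt.fun_sum fun i _ =>
          (((hasDerivAt_pow i s).div_const _).const_mul _).hasDerivWithinAt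
      refine h2.congr_deriv ?_
      rw [Finset.sum_range_succ']
      simp only [Nat.cast_zero, zero_mul, zero_div, mul_zero, add_zero, Nat.add_sub_cancel]
      refine Finset.sum_congr rfl fun i _ => ?_
      rw [Nat.factorial_succ]
      push_cast
      have : (i.factorial : ℝ) ≠ 0 := by positivity
      have : (i : ℝ) + 1 ≠ 0 := by positivity
      field_simp
    have h3 := (convex_Icc (0 : ℝ) 1).norm_image_sub_le_of_norm_hasDerivWithin_le hder
      (C := B) h1 (left_mem_Icc.mpr zero_le_one) hs
    have h0 : φ 0 0 - ∑ i ∈ Finset.range (m + 1), φ i 0 * ((0 : ℝ) ^ i / (i.factorial : ℝ)) = 0 := by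
      rw [Finset.sum_range_succ']
      simp
    rw [h0, sub_zero, sub_zero, Real.norm_eq_abs, Real.norm_eq_abs, abs_of_nonneg hs.1] at h3
    have hB0 : 0 ≤ B := (abs_nonneg _).trans (hB 0 (left_mem_Icc.mpr zero_le_one))
    exact h3.trans (mul_le_of_le_one_right hB0 hs.2)

/-- The approximant is the Taylor polynomial at one point of `D`, compared with `f` along segments,
which stay in `D` by convexity. The constant therefore depends on the diameter but not on the shape.
-/
theorem exists_isPoly_approx {D : Set Plane} (hconv : Convex ℝ D) (hne : D.Nonempty) {n : ℕ}
    {f : Plane → ℝ} (hf : ∀ x ∈ D, ContDiffAt ℝ (n + 1 : ℕ) f x) {B h : ℝ}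
    (hB : ∀ x ∈ D, ‖iteratedFDeriv ℝ (n + 1) f x‖ ≤ B) (hh : ∀ x ∈ D, ∀ y ∈ D, dist x y ≤ h) :
    ∃ v, IsPoly n v ∧ ∀ x ∈ D, |f x - v x| ≤ B * h ^ (n + 1) := by
  obtain ⟨x₀, hx₀⟩ := hne
  refine ⟨fun x => ∑ i ∈ Finset.range (n + 1),
    ((i.factorial : ℝ)⁻¹ * iteratedFDeriv ℝ i f x₀ fun _ => x - x₀), ?_, ?_⟩
  · refine IsPoly.sum _ fun i hi => ((isPoly_multilinear _ x₀).const_mul _).mono ?_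
    exact Nat.lt_succ_iff.mp (Finset.mem_range.mp hi)
  intro x hx
  have hline : ∀ s ∈ Icc (0 : ℝ) 1, x₀ + s • (x - x₀) ∈ D := fun s hs =>
    hconv.add_smul_sub_mem hx₀ hx hs
  have key := abs_sub_taylor_le (B := B * h ^ (n + 1)) (n + 1)
    (fun i s => iteratedFDeriv ℝ i f (x₀ + s • (x - x₀)) fun _ => x - x₀) ?_ ?_ 1
    (right_mem_Icc.mpr zero_le_one)
  · convert key using 3
    · simp
    · refine Finset.sum_congr rfl fun i _ => ?_
      simp [mul_comm]
  · intro i hi s hs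
    have hd : DifferentiableAt ℝ (iteratedFDeriv ℝ i f) (x₀ + s • (x - x₀)) :=
      (hf _ (hline s hs)).differentiableAt_iteratedFDeriv (by exact_mod_cast hi)
    have hl : HasDerivAt (fun s : ℝ => x₀ + s • (x - x₀)) (x - x₀) s := by
      simpa using ((hasDerivAt_id s).smul_const (x - x₀)).const_add x₀
    have h1 := hd.hasFDerivAt.comp_hasDerivAt s hl
    have h2 := ((ContinuousMultilinearMap.apply ℝ (fun _ : Fin i => Plane) ℝ
      fun _ => x - x₀).hasFDerivAt).comp_hasDerivAt s h1
    exact (HasDerivAt.congr_deriv h2 rfl).hasDerivWithinAt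
  · intro s hs
    rw [← Real.norm_eq_abs]
    refine (ContinuousMultilinearMap.le_opNorm _ _).trans ?_
    rw [Finset.prod_const, Finset.card_univ, Fintype.card_fin]
    have h1 : ‖x - x₀‖ ≤ h := by rw [← dist_eq_norm]; exact hh x hx x₀ hx₀
    have h2 := hB _ (hline s hs)
    gcongr
    exact (norm_nonneg _).trans h2

/-! ### An inverse estimate for polynomials on triangles -/

/-- In coordinates with respect to a basis, the squared `L²` norm is a positive definite quadratic
form, so it has a positive minimum `μ` on the unit sphere of coefficients; homogeneity does the
rest. -/
theorem exists_sup_le_integral_sq {D : Set Plane} (hD : IsCompact D) (n : ℕ)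
    (h0 : ∀ f, IsPoly n f → ∫ x in D, f x ^ 2 = 0 → f = 0) :
    ∃ C, 0 ≤ C ∧ ∀ f, IsPoly n f → ∀ x ∈ D, f x ^ 2 ≤ C * ∫ y in D, f y ^ 2 := by
  set b := Module.finBasis ℝ (polySpace n) with hb
  set d := Module.finrank ℝ (polySpace n)
  have hbc : ∀ i, Continuous (b i : Plane → ℝ) := fun i => IsPoly.continuous (b i).2
  have hint : ∀ i j, IntegrableOn (fun x => (b i : Plane → ℝ) x * (b j : Plane → ℝ) x) D :=
    fun i j => ((hbc i).mul (hbc j)).continuousOn.integrableOn_compact hD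
  let F : (Fin d → ℝ) → Plane → ℝ := fun c x => ∑ i, c i * (b i : Plane → ℝ) x
  have hFp : ∀ c, IsPoly n (F c) := fun c => IsPoly.sum _ fun i _ => IsPoly.const_mul _ (b i).2
  have hF0 : ∀ c, F c = 0 → c = 0 := by
    intro c hc
    have h1 : ∑ i, c i • b i = 0 := by
      apply Subtype.ext
      refine Eq.trans ?_ hc
      ext x
      simp [F]
    exact funext fun i => Fintype.linearIndependent_iff.mp b.linearIndependent c h1 i
  let Q : (Fin d → ℝ) → ℝ := fun c => ∫ x in D, F c x ^ 2
  have hQ : ∀ c, Q c = ∑ i, ∑ j, c i * c j *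
      ∫ x in D, (b i : Plane → ℝ) x * (b j : Plane → ℝ) x := by
    intro c
    have h1 : ∀ x, F c x ^ 2 = ∑ i, ∑ j, c i * c j * ((b i : Plane → ℝ) x * (b j : Plane → ℝ) x) := by
      intro x
      simp only [F, sq, Finset.sum_mul_sum]
      exact Finset.sum_congr rfl fun i _ => Finset.sum_congr rfl fun j _ => by ring
    simp only [Q, h1]
    rw [integral_finsetSum _ fun i _ => integrable_finsetSum _ fun j _ =>
      (hint i j).const_mul _]
    refine Finset.sum_congr rfl fun i _ => ?_
    rw [integral_finsetSum _ fun j _ => (hint i j).const_mul _]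
    exact Finset.sum_congr rfl fun j _ => integral_const_mul _ _
  have hQc : Continuous Q := by
    rw [funext hQ]
    fun_prop
  have hQpos : ∀ c ∈ Metric.sphere (0 : Fin d → ℝ) 1, 0 < Q c := by
    intro c hc
    refine lt_of_le_of_ne (integral_nonneg fun x => sq_nonneg _) fun h => ?_
    have := hF0 c (h0 _ (hFp c) h.symm)
    rw [this] at hc
    simp at hc
  obtain ⟨μ, hμ, hQμ⟩ := (isCompact_sphere (0 : Fin d → ℝ) 1).exists_forall_le' hQc.continuousOn
    hQpos
  have hBi : ∀ i, ∃ B, 0 ≤ B ∧ ∀ x ∈ D, |(b i : Plane → ℝ) x| ≤ B := by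
    intro i
    obtain ⟨B, hB⟩ := hD.exists_bound_of_continuousOn (hbc i).continuousOn
    exact ⟨max B 0, le_max_right _ _, fun x hx => (hB x hx).trans (le_max_left _ _)⟩
  choose B hB0 hB using hBi
  refine ⟨(∑ i, B i) ^ 2 / μ, by positivity, fun f hf x hx => ?_⟩
  set c : Fin d → ℝ := fun i => b.repr ⟨f, hf⟩ i with hc
  have hfc : f = F c := by
    have h1 := congrArg Subtype.val (b.sum_repr ⟨f, hf⟩)
    ext y
    refine (congrFun h1 y).symm.trans ?_
    simp only [F, hc, Submodule.coe_sum, Finset.sum_apply, Submodule.coe_smul, Pi.smul_apply,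
      smul_eq_mul]
  have h1 : |f x| ≤ ‖c‖ * ∑ i, B i := by
    rw [hfc, Finset.mul_sum]
    refine (Finset.abs_sum_le_sum_abs _ _).trans (Finset.sum_le_sum fun i _ => ?_)
    rw [abs_mul]
    exact mul_le_mul (norm_le_pi_norm c i) (hB i x hx) (abs_nonneg _) (norm_nonneg _)
  have h2 : μ * ‖c‖ ^ 2 ≤ ∫ y in D, f y ^ 2 := by
    rw [hfc]
    change _ ≤ Q c
    rcases eq_or_ne c 0 with h | h
    · rw [h]
      simpa using integral_nonneg fun x => sq_nonneg _
    · have hn : ‖c‖ ≠ 0 := norm_ne_zero_iff.mpr h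
      have h3 := hQμ (‖c‖⁻¹ • c) (by simp [norm_smul, hn])
      have h4 : Q (‖c‖⁻¹ • c) = (‖c‖⁻¹) ^ 2 * Q c := by
        rw [hQ, hQ, Finset.mul_sum]
        refine Finset.sum_congr rfl fun i _ => ?_
        rw [Finset.mul_sum]
        refine Finset.sum_congr rfl fun j _ => ?_
        simp only [Pi.smul_apply, smul_eq_mul]
        ring
      rw [h4, inv_pow, inv_mul_eq_div, le_div_iff₀ (by positivity)] at h3
      exact h3
  have h3 : f x ^ 2 ≤ (‖c‖ * ∑ i, B i) ^ 2 := by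
    rw [← sq_abs]
    gcongr
  refine h3.trans ?_
  rw [mul_pow, div_mul_eq_mul_div, le_div_iff₀ hμ]
  nlinarith [sq_nonneg (∑ i, B i)]

/-- The reference triangle. -/
def refTriangle : Set Plane :=
  convexHull ℝ (range ![(0 : Plane), EuclideanSpace.single 0 1, EuclideanSpace.single 1 1])

theorem mem_refTriangle {x : Plane} (h0 : 0 ≤ x 0) (h1 : 0 ≤ x 1) (h : x 0 + x 1 ≤ 1) :
    x ∈ refTriangle := by
  have hx : x = ∑ i : Fin 3, (![1 - x 0 - x 1, x 0, x 1] : Fin 3 → ℝ) i •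
      (![(0 : Plane), EuclideanSpace.single 0 1, EuclideanSpace.single 1 1] : Fin 3 → Plane) i := by
    ext i; fin_cases i <;> simp [Fin.sum_univ_three]
  rw [hx]
  refine (convex_convexHull ℝ _).sum_mem ?_ ?_ fun i _ => subset_convexHull ℝ _ ⟨i, rfl⟩
  · intro i _
    fin_cases i <;> simp <;> linarith
  · simp [Fin.sum_univ_three]
    ring

theorem isCompact_triangle (v : Fin 3 → Plane) : IsCompact (convexHull ℝ (range v)) :=
  (finite_range v).isCompact_convexHull ℝ

/-- The polynomial vanishes almost everywhere on the open triangle, by continuity everywhere on it,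
and a polynomial vanishing on a product of infinite sets is zero. -/
theorem isPoly_eq_zero_of_integral_refTriangle {n : ℕ} {f : Plane → ℝ} (hf : IsPoly n f)
    (h : ∫ x in refTriangle, f x ^ 2 = 0) : f = 0 := by
  have hD : IsCompact refTriangle := isCompact_triangle _
  have hi : IntegrableOn (fun x => f x ^ 2) refTriangle :=
    (hf.continuous.pow 2).continuousOn.integrableOn_compact hD
  set U : Set Plane := {x | 0 < x 0 ∧ 0 < x 1 ∧ x 0 + x 1 < 1} with hU
  have hUo : IsOpen U := by
    have c0 : Continuous fun x : Plane => x 0 := (IsPoly.coord 0).continuous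
    have c1 : Continuous fun x : Plane => x 1 := (IsPoly.coord 1).continuous
    exact (isOpen_lt continuous_const c0).inter
      ((isOpen_lt continuous_const c1).inter (isOpen_lt (c0.add c1) continuous_const))
  have hUD : U ⊆ refTriangle := fun x hx => mem_refTriangle hx.1.le hx.2.1.le hx.2.2.le
  have hz := (integral_eq_zero_iff_of_nonneg (fun x => sq_nonneg (f x)) hi).mp h
  have hz' : (fun x => f x ^ 2) =ᵐ[volume.restrict U] fun _ => 0 :=
    ae_mono (Measure.restrict_mono hUD le_rfl) hz
  have hE := Measure.eqOn_open_of_ae_eq hz' hUo (hf.continuous.pow 2).continuousOn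
    continuousOn_const
  obtain ⟨P, hP, hfP⟩ := hf
  have hP0 : P = 0 := by
    refine MvPolynomial.funext_set (fun _ => Ioo (0 : ℝ) (1 / 2))
      (fun _ => Ioo_infinite (by norm_num)) fun x hx => ?_
    have h0 := hx 0 (mem_univ _)
    have h1 := hx 1 (mem_univ _)
    have h2 : (WithLp.toLp 2 x : Plane) ∈ U := by
      refine ⟨h0.1, h1.1, ?_⟩
      have := h0.2; have := h1.2
      change x 0 + x 1 < 1
      linarith
    have h3 := hE h2
    simp only [hfP, pow_eq_zero_iff two_ne_zero] at h3
    simpa using h3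
  ext x
  simp [hfP, hP0]

/-- The inverse estimate between the maximum norm and the `L²` norm on triangles: the constant is
independent of the triangle. -/
theorem exists_inverse_estimate (n : ℕ) : ∃ C, 0 ≤ C ∧ ∀ v : Fin 3 → Plane,
    AffineIndependent ℝ v → ∀ f, IsPoly n f → ∀ x ∈ convexHull ℝ (range v),
      f x ^ 2 * volume.real (convexHull ℝ (range v)) ≤
        C * ∫ y in convexHull ℝ (range v), f y ^ 2 := by
  have hDr : IsCompact refTriangle := isCompact_triangle _
  obtain ⟨C, hC, hCf⟩ := exists_sup_le_integral_sq hDr n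
    fun f hf h => isPoly_eq_zero_of_integral_refTriangle hf h
  refine ⟨C * volume.real refTriangle, by positivity, fun v hv f hf x hx => ?_⟩
  -- The linear part of the affine map from the reference triangle; its determinant scales the area
  -- and the integral alike and so drops out of the estimate.
  let L : Plane →L[ℝ] Plane :=
    (EuclideanSpace.proj (𝕜 := ℝ) (0 : Fin 2)).smulRight (v 1 - v 0) +
      (EuclideanSpace.proj (𝕜 := ℝ) (1 : Fin 2)).smulRight (v 2 - v 0)
  have hL : ∀ x, L x = x 0 • (v 1 - v 0) + x 1 • (v 2 - v 0) := fun x => rfl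
  let Φ : Plane →ᵃ[ℝ] Plane := (L : Plane →ₗ[ℝ] Plane).toAffineMap + AffineMap.const ℝ Plane (v 0)
  have hΦ : ∀ x, Φ x = L x + v 0 := fun x => rfl
  have hinj : Function.Injective Φ := by
    intro x y hxy
    rw [hΦ, hΦ, add_left_inj] at hxy
    have h1 : L (x - y) = 0 := by rw [map_sub, hxy, sub_self]
    rw [affineIndependent_iff] at hv
    have h2 := hv Finset.univ ![-((x - y) 0) - (x - y) 1, (x - y) 0, (x - y) 1]
      (by simp [Fin.sum_univ_three]; ring) (by
        rw [hL] at h1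
        simp only [Fin.sum_univ_three, Matrix.cons_val]
        rw [← h1]
        module)
    have h3 : x - y = 0 := by
      ext i
      fin_cases i
      · simpa using h2 1 (Finset.mem_univ _)
      · simpa using h2 2 (Finset.mem_univ _)
    exact sub_eq_zero.mp h3
  have himg : convexHull ℝ (range v) = Φ '' refTriangle := by
    rw [refTriangle, AffineMap.image_convexHull, ← range_comp]
    congr 2
    ext i : 1
    fin_cases i <;> simp [hΦ, hL]
  have hder : ∀ x ∈ refTriangle, HasFDerivWithinAt Φ L refTriangle x := fun x _ =>
    (L.hasFDerivAt.add_const (v 0)).hasFDerivWithinAt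
  have hint : ∀ g : Plane → ℝ, ∫ y in Φ '' refTriangle, g y =
      |L.det| * ∫ y in refTriangle, g (Φ y) := by
    intro g
    rw [integral_image_eq_integral_abs_det_fderiv_smul volume hDr.measurableSet hder
      hinj.injOn g]
    simp [integral_const_mul]
  have hvol : volume.real (Φ '' refTriangle) = |L.det| * volume.real refTriangle := by
    have := hint fun _ => 1
    simpa using this
  have hfΦ : IsPoly n fun y => f (Φ y) := by
    refine hf.comp_affine fun i => ?_
    exact (isPoly_linear ((EuclideanSpace.proj (𝕜 := ℝ) i).comp L)).add (IsPoly.const 1 (v 0 i))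
  rw [himg] at hx ⊢
  obtain ⟨y, hy, rfl⟩ := hx
  rw [hvol, hint]
  have := hCf _ hfΦ y hy
  have h1 : 0 ≤ |L.det| * volume.real refTriangle := by positivity
  calc f (Φ y) ^ 2 * (|L.det| * volume.real refTriangle)
      ≤ (C * ∫ y in refTriangle, f (Φ y) ^ 2) * (|L.det| * volume.real refTriangle) := by gcongr
    _ = _ := by ring

/-! ### Estimates on one element -/

theorem norm_iteratedFDeriv_mul_le_of_le {f g : Plane → ℝ} {n : ℕ} {A B : ℝ} {x : Plane}
    (hf : ContDiff ℝ n f) (hg : ContDiff ℝ n g)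
    (hfA : ∀ r ≤ n, ‖iteratedFDeriv ℝ r f x‖ ≤ A) (hgB : ∀ r ≤ n, ‖iteratedFDeriv ℝ r g x‖ ≤ B) :
    ‖iteratedFDeriv ℝ n (fun y => f y * g y) x‖ ≤ 2 ^ n * A * B := by
  refine (norm_iteratedFDeriv_mul_le hf hg x le_rfl).trans ?_
  have hA : 0 ≤ A := (norm_nonneg _).trans (hfA 0 (Nat.zero_le _))
  calc ∑ i ∈ Finset.range (n + 1), (n.choose i : ℝ) * ‖iteratedFDeriv ℝ i f x‖ *
        ‖iteratedFDeriv ℝ (n - i) g x‖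
      ≤ ∑ i ∈ Finset.range (n + 1), (n.choose i : ℝ) * A * B := by
        refine Finset.sum_le_sum fun i hi => ?_
        have h1 := hfA i (Nat.lt_succ_iff.mp (Finset.mem_range.mp hi))
        have h2 := hgB (n - i) (Nat.sub_le _ _)
        gcongr
    _ = 2 ^ n * A * B := by
        rw [← Finset.sum_mul, ← Finset.sum_mul]
        congr 2
        exact_mod_cast Nat.sum_range_choose n

/-- If `e` is the `L²` projection of `d`, it is at least as close to `d` as any polynomial. -/
theorem integral_sq_sub_le_of_orthogonal {D : Set Plane} (hD : IsCompact D) {n : ℕ}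
    {d e v : Plane → ℝ} (hd : ContinuousOn d D) (he : IsPoly n e) (hv : IsPoly n v)
    (h : ∀ θ, IsPoly n θ → ∫ x in D, e x * θ x = ∫ x in D, d x * θ x) :
    ∫ x in D, (e x - d x) ^ 2 ≤ ∫ x in D, (d x - v x) ^ 2 := by
  have hec := he.continuous.continuousOn (s := D)
  have hvc := hv.continuous.continuousOn (s := D)
  have i1 : IntegrableOn (fun x => e x * (e x - v x)) D :=
    (hec.mul (hec.sub hvc)).integrableOn_compact hD
  have i2 : IntegrableOn (fun x => d x * (e x - v x)) D :=
    (hd.mul (hec.sub hvc)).integrableOn_compact hD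
  have i3 : IntegrableOn (fun x => (d x - v x) ^ 2) D :=
    ((hd.sub hvc).pow 2).integrableOn_compact hD
  have i4 : IntegrableOn (fun x => (e x - d x) ^ 2) D :=
    ((hec.sub hd).pow 2).integrableOn_compact hD
  have i5 : IntegrableOn (fun x => 2 * (e x * (e x - v x) - d x * (e x - v x))) D :=
    (i1.sub i2).const_mul 2
  have h0 : ∫ x in D, (e x * (e x - v x) - d x * (e x - v x)) = 0 := by
    rw [integral_sub i1 i2, h _ (he.sub hv), sub_self]
  -- Pythagoras: `(e - d)² = (d - v)² + 2 (e - d)(e - v) - (e - v)²`, where the mixed term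
  -- integrates to zero.
  have h1 : ∫ x in D, (e x - d x) ^ 2 ≤
      ∫ x in D, ((d x - v x) ^ 2 + 2 * (e x * (e x - v x) - d x * (e x - v x))) := by
    refine integral_mono i4 (i3.add i5) fun x => ?_
    change (e x - d x) ^ 2 ≤ (d x - v x) ^ 2 + 2 * (e x * (e x - v x) - d x * (e x - v x))
    nlinarith [sq_nonneg (e x - v x)]
  rwa [integral_add i3 i5, integral_const_mul, h0, mul_zero,
    add_zero] at h1

theorem setIntegral_le_of_forall_le {D : Set Plane} (hD : IsCompact D) {f : Plane → ℝ} {B : ℝ}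
    (hf : ContinuousOn f D) (h : ∀ x ∈ D, f x ≤ B) : ∫ x in D, f x ≤ B * volume.real D := by
  have h1 := setIntegral_mono_on (hf.integrableOn_compact hD)
    (integrableOn_const (μ := volume) (C := B) hD.measure_ne_top) hD.measurableSet h
  rwa [setIntegral_const, smul_eq_mul, mul_comm] at h1

/-- The approximation property of the weight-adjusted projection. -/
theorem integral_weightAdjusted_sq_le {D : Set Plane} (hD : IsCompact D) {n : ℕ} {Jmin δ : ℝ}
    (hJmin : 0 < Jmin) {p q J v : Plane → ℝ} (hp : IsPoly n p) (hq : IsPoly n q)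
    (hJ : ContinuousOn J D) (hJlow : ∀ x ∈ D, Jmin ≤ J x) (hv : IsPoly n v)
    (hvq : ∀ x ∈ D, |q x * J x - v x| ≤ δ)
    (h : ∀ w, IsPoly n w → ∫ x in D, (p x / J x - q x) * w x = 0) :
    ∫ x in D, (p x / J x - q x) ^ 2 ≤ (δ / Jmin) ^ 2 * volume.real D := by
  have hJpos : ∀ x ∈ D, 0 < J x := fun x hx => hJmin.trans_le (hJlow x hx)
  have hpc := hp.continuous.continuousOn (s := D)
  have hqc := hq.continuous.continuousOn (s := D)
  have hvc := hv.continuous.continuousOn (s := D)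
  have hz : ContinuousOn (fun x => p x / J x - q x) D :=
    (hpc.div hJ fun x hx => (hJpos x hx).ne').sub hqc
  have i1 : IntegrableOn (fun x => (p x / J x - q x) ^ 2) D := (hz.pow 2).integrableOn_compact hD
  have i2 : IntegrableOn (fun x => (p x / J x - q x) * (p x - v x)) D :=
    (hz.mul (hpc.sub hvc)).integrableOn_compact hD
  have i3 : IntegrableOn (fun _ : Plane => (δ / Jmin) ^ 2) D :=
    integrableOn_const hD.measure_ne_top
  have h1 : ∫ x in D, (p x / J x - q x) ^ 2 ≤
      ∫ x in D, ((δ / Jmin) ^ 2 + 2 / Jmin * ((p x / J x - q x) * (p x - v x))) := by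
    refine setIntegral_mono_on i1 (i3.add (i2.const_mul _)) hD.measurableSet fun x hx => ?_
    have hJx := hJpos x hx
    set z := p x / J x - q x with hz
    have hp' : p x = (z + q x) * J x := by rw [hz]; field_simp; try ring
    have hδ : (q x * J x - v x) ^ 2 ≤ δ ^ 2 := sq_le_sq' (by
      have := neg_abs_le (q x * J x - v x); linarith [hvq x hx]) ((le_abs_self _).trans (hvq x hx))
    change z ^ 2 ≤ (δ / Jmin) ^ 2 + 2 / Jmin * (z * (p x - v x))
    -- Here `p - v = J z + (q J - v)`. The product `J z²` controls `Jmin z²`, and completing the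
    -- square absorbs the approximation error. The remaining `z (p - v)` vanishes after integration,
    -- as `p - v` is an admissible test function.
    have key : Jmin ^ 2 * z ^ 2 ≤ δ ^ 2 + 2 * Jmin * (z * (p x - v x)) := by
      rw [hp']
      have h3 : Jmin ^ 2 * z ^ 2 ≤ J x * Jmin * z ^ 2 := by
        have := hJlow x hx
        have : 0 ≤ z ^ 2 := sq_nonneg z
        rw [sq Jmin]
        gcongr
      nlinarith [sq_nonneg (q x * J x - v x + Jmin * z), mul_nonneg hJmin.le (hJpos x hx).le,
        sq_nonneg z]
    have h4 : (δ / Jmin) ^ 2 + 2 / Jmin * (z * (p x - v x)) =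
        (δ ^ 2 + 2 * Jmin * (z * (p x - v x))) / Jmin ^ 2 := by field_simp
    rw [h4, le_div_iff₀ (by positivity)]
    linarith
  rw [integral_add i3 (i2.const_mul _), integral_const_mul, h _ (hp.sub hv), mul_zero, add_zero,
    setIntegral_const, smul_eq_mul, mul_comm] at h1
  exact h1

/-- The four terms of the consistency error after subtraction of the polynomials `v₂` and `v₄`, each
bounded by Young's inequality so that only the squares of `z`, `w` and `η` remain. -/
theorem abs_splitting_le {z w q d e v₂ v₄ A E G c η : ℝ} (hc : 0 ≤ c) (hq : |q| ≤ A)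
    (he : |e| ≤ E) (hv₂ : |q * d - v₂| ≤ c * A * G * η)
    (hv₄ : |q * q - v₄| ≤ c * A * A * η) :
    |z ^ 2 * e + 2 * (z * (q * w)) + 2 * (z * (q * d - v₂)) + (q * q - v₄) * w| ≤
      (E + 2) * z ^ 2 + (1 + c) * A ^ 2 * w ^ 2 + ((c * A * G * η) ^ 2 + c * A ^ 2 * η ^ 2) := by
  have two (a b : ℝ) : |2 * (a * b)| ≤ a ^ 2 + b ^ 2 := by
    rw [abs_le]
    constructor <;> nlinarith [sq_nonneg (a - b), sq_nonneg (a + b)]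
  have t1 : |z ^ 2 * e| ≤ E * z ^ 2 := by
    rw [abs_mul, abs_of_nonneg (sq_nonneg z), mul_comm]
    exact mul_le_mul_of_nonneg_right he (sq_nonneg z)
  have t2 : |2 * (z * (q * w))| ≤ z ^ 2 + A ^ 2 * w ^ 2 := by
    have h2 : q ^ 2 ≤ A ^ 2 := by
      rw [← sq_abs]; gcongr
    have h3 := mul_le_mul_of_nonneg_right h2 (sq_nonneg w)
    linarith [mul_pow q w 2, two z (q * w)]
  have t3 : |2 * (z * (q * d - v₂))| ≤ z ^ 2 + (c * A * G * η) ^ 2 := by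
    have h2 : (q * d - v₂) ^ 2 ≤ (c * A * G * η) ^ 2 := by
      rw [← sq_abs]; gcongr
    linarith [two z (q * d - v₂)]
  have t4 : |(q * q - v₄) * w| ≤ c * A ^ 2 * η ^ 2 + c * A ^ 2 * w ^ 2 := by
    rw [abs_mul]
    have h1 := mul_le_mul_of_nonneg_right hv₄ (abs_nonneg w)
    have h2 : η * |w| ≤ η ^ 2 + w ^ 2 := by
      rw [← sq_abs w]; nlinarith [sq_nonneg (η - |w|), sq_nonneg η, sq_nonneg (|w|)]
    have h3 := mul_le_mul_of_nonneg_left h2 (show 0 ≤ c * A ^ 2 by positivity)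
    calc _ ≤ c * A * A * η * |w| := h1
      _ = c * A ^ 2 * (η * |w|) := by ring
      _ ≤ _ := h3.trans (le_of_eq (by ring))
  have := abs_add_le (z ^ 2 * e + 2 * (z * (q * w)) + 2 * (z * (q * d - v₂))) ((q * q - v₄) * w)
  have := abs_add_le (z ^ 2 * e + 2 * (z * (q * w))) (2 * (z * (q * d - v₂)))
  have := abs_add_le (z ^ 2 * e) (2 * (z * (q * w)))
  linarith

/-- A polynomial on a triangle has its derivatives bounded by their `L²` norms. -/
theorem norm_iteratedFDeriv_le_of_inverse_estimate {N : ℕ} {C₀ A S : ℝ} {D : Set Plane}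
    (hD : IsCompact D) (hC₀ : 0 ≤ C₀) (hV : 0 < volume.real D) (hA : 0 ≤ A)
    (hAV : A ^ 2 * volume.real D = C₀ * S)
    (hinv : ∀ f, IsPoly N f → ∀ x ∈ D, f x ^ 2 * volume.real D ≤ C₀ * ∫ y in D, f y ^ 2)
    {q : Plane → ℝ} (hq : IsPoly N q) {r : ℕ}
    (hS : ∫ x in D, ‖iteratedFDeriv ℝ r q x‖ ^ 2 ≤ S) {x : Plane} (hx : x ∈ D) :
    ‖iteratedFDeriv ℝ r q x‖ ≤ A := by
  refine ContinuousMultilinearMap.opNorm_le_bound hA fun m => ?_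
  have h1 := hinv _ (hq.iteratedFDeriv_apply r m) x hx
  have hcd : Continuous (iteratedFDeriv ℝ r q) :=
    (hq.contDiff (k := ∞)).continuous_iteratedFDeriv (by exact_mod_cast le_top)
  have h2 : ∫ y in D, (iteratedFDeriv ℝ r q y m) ^ 2 ≤ (∏ i, ‖m i‖) ^ 2 * S := by
    refine le_trans ?_ (mul_le_mul_of_nonneg_left hS (sq_nonneg _))
    rw [← integral_const_mul]
    refine integral_mono (((hq.iteratedFDeriv_apply r m).continuous.pow 2).continuousOn
      |>.integrableOn_compact hD) ((continuous_const.mul (hcd.norm.pow 2)).continuousOn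
      |>.integrableOn_compact hD) fun y => ?_
    have h3 := (iteratedFDeriv ℝ r q y).le_opNorm m
    rw [Real.norm_eq_abs] at h3
    calc (iteratedFDeriv ℝ r q y m) ^ 2 = |iteratedFDeriv ℝ r q y m| ^ 2 := (sq_abs _).symm
      _ ≤ (‖iteratedFDeriv ℝ r q y‖ * ∏ i, ‖m i‖) ^ 2 := by gcongr
      _ = (∏ i, ‖m i‖) ^ 2 * ‖iteratedFDeriv ℝ r q y‖ ^ 2 := by ring
  have h3 : (iteratedFDeriv ℝ r q x m) ^ 2 ≤ (A * ∏ i, ‖m i‖) ^ 2 := by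
    refine le_of_mul_le_mul_right ?_ hV
    calc (iteratedFDeriv ℝ r q x m) ^ 2 * volume.real D
        ≤ C₀ * ((∏ i, ‖m i‖) ^ 2 * S) := h1.trans (by gcongr)
      _ = (∏ i, ‖m i‖) ^ 2 * (A ^ 2 * volume.real D) := by rw [hAV]; ring
      _ = _ := by ring
  exact abs_le_of_sq_le_sq h3 (mul_nonneg hA (Finset.prod_nonneg fun i _ => norm_nonneg _))

/-- The core consistency bound: `p / J - q` and `e - d` are both orthogonal to polynomials and both
of order `N + 1`, which doubles the order of the error. The local Sobolev norm is kept as a factor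
so that the bounds can be summed over any number of elements. -/
theorem exists_element_estimate (N : ℕ) {Jmin Jmax G : ℝ} (hJmin : 0 < Jmin)
    (hG : 0 ≤ G) : ∃ C, 0 ≤ C ∧ ∀ v : Fin 3 → Plane, AffineIndependent ℝ v →
      ∀ (h : ℝ) (p q J d e : Plane → ℝ),
      (∀ x ∈ convexHull ℝ (range v), ∀ y ∈ convexHull ℝ (range v), dist x y ≤ h) →
      IsPoly N p → IsPoly N q → IsPoly N e → ContDiff ℝ (N + 1 : ℕ) J →
      ContDiff ℝ (N + 1 : ℕ) d →
      (∀ x ∈ convexHull ℝ (range v), Jmin ≤ J x) →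
      (∀ x ∈ convexHull ℝ (range v), ∀ r ≤ N + 1, ‖iteratedFDeriv ℝ r J x‖ ≤ Jmax) →
      (∀ x ∈ convexHull ℝ (range v), ∀ r ≤ N + 1, ‖iteratedFDeriv ℝ r d x‖ ≤ G) →
      (∀ w, IsPoly N w → ∫ x in convexHull ℝ (range v), q x * w x =
        ∫ x in convexHull ℝ (range v), p x / J x * w x) →
      (∀ θ, IsPoly N θ → ∫ x in convexHull ℝ (range v), e x * θ x =
        ∫ x in convexHull ℝ (range v), d x * θ x) →
      |∫ x in convexHull ℝ (range v), ((p x / J x) ^ 2 * e x - d x * q x ^ 2)| ≤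
        C * h ^ (2 * N + 2) * ∑ r ∈ Finset.range (N + 1 + 1),
          ∫ x in convexHull ℝ (range v), ‖iteratedFDeriv ℝ r q x‖ ^ 2 := by
  obtain ⟨C₀, hC₀, hinv⟩ := exists_inverse_estimate N
  set c : ℝ := 2 ^ (N + 1) with hc
  have hcpos : 0 < c := by positivity
  -- A bound for `e`, which is only known as the projection of `d`. The inverse estimate gives `√C₀
  -- * G`; `1 + C₀` avoids the root.
  set E : ℝ := (1 + C₀) * G with hE
  have hEnn : 0 ≤ E := by positivity
  -- The coefficients of `abs_splitting_le`, with the squared `L²` bounds of `p / J - q` and `e - d`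
  -- inserted and the common factor `A² η² V` removed.
  set κ : ℝ := (E + 2) * (c * Jmax / Jmin) ^ 2 + ((1 + c) * G ^ 2 + (c * G) ^ 2 + c) with hκ
  have hκnn : 0 ≤ κ := by positivity
  refine ⟨C₀ * κ, by positivity, ?_⟩
  intro v hv h p q J d e hdist hp hq he hJ hd hJlow hJreg hdreg hwadg hgcl
  set D := convexHull ℝ (range v) with hDdef
  set S := ∑ r ∈ Finset.range (N + 1 + 1), ∫ x in D, ‖iteratedFDeriv ℝ r q x‖ ^ 2 with hS
  have hD : IsCompact D := isCompact_triangle v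
  have hconv : Convex ℝ D := convex_convexHull ℝ _
  have hx₀ : v 0 ∈ D := subset_convexHull ℝ _ ⟨0, rfl⟩
  have hh : 0 ≤ h := dist_nonneg.trans (hdist _ hx₀ _ hx₀)
  have hSr : ∀ r ≤ N + 1, ∫ x in D, ‖iteratedFDeriv ℝ r q x‖ ^ 2 ≤ S := fun r hr =>
    Finset.single_le_sum (f := fun r => ∫ x in D, ‖iteratedFDeriv ℝ r q x‖ ^ 2)
      (fun r _ => integral_nonneg fun x => sq_nonneg _) (Finset.mem_range.mpr (by omega))
  have hSnn : 0 ≤ S := Finset.sum_nonneg fun r _ => integral_nonneg fun x => sq_nonneg _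
  rcases eq_or_lt_of_le (measureReal_nonneg (μ := volume) (s := D)) with hV | hV
  · have h0 : volume.restrict D = 0 := by
      rw [Measure.restrict_eq_zero]
      exact (measureReal_eq_zero_iff hD.measure_ne_top).mp hV.symm
    rw [h0]
    simp only [integral_zero_measure, abs_zero]
    positivity
  set V := volume.real D with hVdef
  -- The common pointwise bound for all derivatives of `q` up to order `N + 1`. It may blow up on
  -- small triangles, but only `A² V = C₀ S` appears in the end.
  set A := √(C₀ * S / V) with hA
  have hAnn : 0 ≤ A := Real.sqrt_nonneg _
  have hAV : A ^ 2 * V = C₀ * S := by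
    rw [hA, Real.sq_sqrt (by positivity)]
    field_simp
  have hqA : ∀ x ∈ D, ∀ r ≤ N + 1, ‖iteratedFDeriv ℝ r q x‖ ≤ A := fun x hx r hr =>
    norm_iteratedFDeriv_le_of_inverse_estimate hD hC₀ hV hAnn hAV (hinv v hv) hq (hSr r hr) hx
  have hq0 : ∀ x ∈ D, |q x| ≤ A := fun x hx => by
    simpa using hqA x hx 0 (Nat.zero_le _)
  have hd0 : ∀ x ∈ D, |d x| ≤ G := fun x hx => by
    simpa using hdreg x hx 0 (Nat.zero_le _)
  set η := h ^ (N + 1) with hη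
  have hηnn : 0 ≤ η := by positivity
  have happ := fun (f : Plane → ℝ) (hf : ContDiff ℝ (N + 1 : ℕ) f) (B : ℝ)
      (hB : ∀ x ∈ D, ‖iteratedFDeriv ℝ (N + 1) f x‖ ≤ B) =>
    exists_isPoly_approx hconv ⟨_, hx₀⟩ (fun x _ => hf.contDiffAt) hB hdist
  have hqs : ContDiff ℝ (N + 1 : ℕ) q := hq.contDiff
  -- The approximants serve different terms: that of `q J` bounds `p / J - q`, that of `d` bounds `e
  -- - d`, and those of `q d` and `q²` are subtracted by orthogonality.
  obtain ⟨v₁, hv₁, hv₁q⟩ := happ _ (hqs.mul hJ) (c * A * Jmax) fun x hx =>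
    norm_iteratedFDeriv_mul_le_of_le hqs hJ (hqA x hx) (hJreg x hx)
  obtain ⟨v₂, hv₂, hv₂q⟩ := happ _ (hqs.mul hd) (c * A * G) fun x hx =>
    norm_iteratedFDeriv_mul_le_of_le hqs hd (hqA x hx) (hdreg x hx)
  obtain ⟨v₃, hv₃, hv₃d⟩ := happ _ hd G fun x hx => hdreg x hx _ le_rfl
  obtain ⟨v₄, hv₄, hv₄q⟩ := happ _ (hqs.mul hqs) (c * A * A) fun x hx =>
    norm_iteratedFDeriv_mul_le_of_le hqs hqs (hqA x hx) (hqA x hx)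
  rw [← hη] at hv₁q hv₂q hv₃d hv₄q
  have hJpos : ∀ x ∈ D, 0 < J x := fun x hx => hJmin.trans_le (hJlow x hx)
  have hpc := hp.continuous.continuousOn (s := D)
  have hqc := hq.continuous.continuousOn (s := D)
  have hec := he.continuous.continuousOn (s := D)
  have hJc := hJ.continuous.continuousOn (s := D)
  have hdc := hd.continuous.continuousOn (s := D)
  have hyc : ContinuousOn (fun x => p x / J x) D := hpc.div hJc fun x hx => (hJpos x hx).ne'
  have hzc : ContinuousOn (fun x => p x / J x - q x) D := hyc.sub hqc
  have hzorth : ∀ w, IsPoly N w → ∫ x in D, (p x / J x - q x) * w x = 0 := by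
    intro w hw
    have hwc := hw.continuous.continuousOn (s := D)
    have i1 : IntegrableOn (fun x => p x / J x * w x) D := (hyc.mul hwc).integrableOn_compact hD
    have i2 : IntegrableOn (fun x => q x * w x) D := (hqc.mul hwc).integrableOn_compact hD
    simp only [sub_mul]
    rw [integral_sub i1 i2, hwadg w hw, sub_self]
  have hdorth : ∀ w, IsPoly N w → ∫ x in D, w x * (e x - d x) = 0 := by
    intro w hw
    have hwc := hw.continuous.continuousOn (s := D)
    have i1 : IntegrableOn (fun x => e x * w x) D := (hec.mul hwc).integrableOn_compact hD
    have i2 : IntegrableOn (fun x => d x * w x) D := (hdc.mul hwc).integrableOn_compact hD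
    simp only [mul_comm (w _), sub_mul]
    rw [integral_sub i1 i2, hgcl w hw, sub_self]
  have hZ : ∫ x in D, (p x / J x - q x) ^ 2 ≤ (c * A * Jmax * η / Jmin) ^ 2 * V :=
    integral_weightAdjusted_sq_le hD hJmin hp hq hJc hJlow hv₁ hv₁q hzorth
  have hW : ∫ x in D, (e x - d x) ^ 2 ≤ (G * η) ^ 2 * V := by
    refine (integral_sq_sub_le_of_orthogonal hD hdc he hv₃ hgcl).trans ?_
    refine setIntegral_le_of_forall_le hD ((hdc.sub hv₃.continuous.continuousOn).pow 2)
      fun x hx => ?_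
    rw [← sq_abs]
    have := hv₃d x hx
    gcongr
  have heE : ∀ x ∈ D, |e x| ≤ E := by
    intro x hx
    have h1 := hinv v hv e he x hx
    have h2 : ∫ y in D, e y ^ 2 ≤ G ^ 2 * V := by
      have i1 : IntegrableOn (fun y => e y ^ 2) D := (hec.pow 2).integrableOn_compact hD
      have i2 : IntegrableOn (fun y => d y * e y) D := (hdc.mul hec).integrableOn_compact hD
      have i3 : IntegrableOn (fun y => d y ^ 2) D := (hdc.pow 2).integrableOn_compact hD
      have h3 : 2 * ∫ y in D, e y ^ 2 ≤ (∫ y in D, d y ^ 2) + ∫ y in D, e y ^ 2 := by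
        have h4 : ∫ y in D, e y ^ 2 = ∫ y in D, d y * e y := by
          rw [← hgcl e he]
          simp only [sq]
        rw [← integral_add i3 i1]
        nth_rewrite 1 [h4]
        rw [← integral_const_mul]
        refine integral_mono (i2.const_mul 2) (i3.add i1) fun y => ?_
        change 2 * (d y * e y) ≤ d y ^ 2 + e y ^ 2
        nlinarith [sq_nonneg (d y - e y)]
      have h5 : ∫ y in D, d y ^ 2 ≤ G ^ 2 * V :=
        setIntegral_le_of_forall_le hD (hdc.pow 2) fun x hx => by
          rw [← sq_abs]
          have := hd0 x hx
          gcongr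
      linarith
    have h3 : e x ^ 2 ≤ E ^ 2 := by
      refine le_of_mul_le_mul_right ?_ hV
      calc e x ^ 2 * V ≤ C₀ * (G ^ 2 * V) := h1.trans (by gcongr)
        _ ≤ (1 + C₀) ^ 2 * (G ^ 2 * V) := by gcongr; nlinarith
        _ = E ^ 2 * V := by rw [hE]; ring
    exact abs_le_of_sq_le_sq h3 hEnn
  have j1 : IntegrableOn (fun x => (p x / J x - q x) * v₂ x) D :=
    (hzc.mul hv₂.continuous.continuousOn).integrableOn_compact hD
  have j2 : IntegrableOn (fun x => v₄ x * (e x - d x)) D :=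
    (hv₄.continuous.continuousOn.mul (hec.sub hdc)).integrableOn_compact hD
  have j3 : IntegrableOn (fun x => (p x / J x) ^ 2 * e x - d x * q x ^ 2) D :=
    (((hyc.pow 2).mul hec).sub (hdc.mul (hqc.pow 2))).integrableOn_compact hD
  have j4 : IntegrableOn (fun x => (p x / J x - q x) ^ 2) D := (hzc.pow 2).integrableOn_compact hD
  have j5 : IntegrableOn (fun x => (e x - d x) ^ 2) D :=
    ((hec.sub hdc).pow 2).integrableOn_compact hD
  have j6 : IntegrableOn (fun x => 2 * ((p x / J x - q x) * v₂ x) + v₄ x * (e x - d x)) D :=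
    (j1.const_mul 2).add j2
  have j7 : IntegrableOn (fun x => (p x / J x) ^ 2 * e x - d x * q x ^ 2 -
      (2 * ((p x / J x - q x) * v₂ x) + v₄ x * (e x - d x))) D := j3.sub j6
  have j8 : IntegrableOn (fun x => (E + 2) * (p x / J x - q x) ^ 2 +
      (1 + c) * A ^ 2 * (e x - d x) ^ 2) D := (j4.const_mul _).add (j5.const_mul _)
  have j9 : IntegrableOn (fun _ : Plane => (c * A * G * η) ^ 2 + c * A ^ 2 * η ^ 2) D :=
    integrableOn_const hD.measure_ne_top
  -- The subtracted terms integrate to zero by the two orthogonality relations.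
  have heq : ∫ x in D, ((p x / J x) ^ 2 * e x - d x * q x ^ 2) =
      ∫ x in D, ((p x / J x) ^ 2 * e x - d x * q x ^ 2 -
        (2 * ((p x / J x - q x) * v₂ x) + v₄ x * (e x - d x))) := by
    rw [integral_sub j3 j6, integral_add (j1.const_mul 2) j2,
      integral_const_mul, hzorth v₂ hv₂, hdorth v₄ hv₄]
    simp
  have hbound : |∫ x in D, ((p x / J x) ^ 2 * e x - d x * q x ^ 2)| ≤
      ∫ x in D, ((E + 2) * (p x / J x - q x) ^ 2 + (1 + c) * A ^ 2 * (e x - d x) ^ 2 +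
        ((c * A * G * η) ^ 2 + c * A ^ 2 * η ^ 2)) := by
    rw [heq, ← Real.norm_eq_abs]
    refine (norm_integral_le_integral_norm _).trans ?_
    refine setIntegral_mono_on j7.norm (j8.add j9) hD.measurableSet fun x hx => ?_
    refine le_trans (le_of_eq (congrArg norm ?_)) (abs_splitting_le (z := p x / J x - q x)
      (w := e x - d x) (d := d x) hcpos.le (hq0 x hx) (heE x hx) (hv₂q x hx)
      (hv₄q x hx))
    ring
  refine hbound.trans ?_
  rw [integral_add j8 j9, integral_add (j4.const_mul _) (j5.const_mul _),
    integral_const_mul, integral_const_mul, setIntegral_const, smul_eq_mul]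
  have hη2 : h ^ (2 * N + 2) = η ^ 2 := by rw [hη, ← pow_mul]; congr 1; ring
  calc _ ≤ (E + 2) * ((c * A * Jmax * η / Jmin) ^ 2 * V) +
        (1 + c) * A ^ 2 * ((G * η) ^ 2 * V) +
          V * ((c * A * G * η) ^ 2 + c * A ^ 2 * η ^ 2) := by gcongr
    _ = κ * η ^ 2 * (A ^ 2 * V) := by rw [hκ]; ring
    _ = _ := by rw [hAV, hη2]; ring

section

/-! ### Geometric factors -/

/-- The cofactors `J ∂ξ_j / ∂x_i`, as polynomials in the derivatives of the motion. -/
noncomputable def cofactor (X : ℝ → Plane → Plane) (j i : Fin 2) (t : ℝ) (x : Plane) : ℝ :=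
  (jacMatrix X t x).adjugate j i

/-- The component `i` of the mesh velocity. -/
noncomputable def velocity (X : ℝ → Plane → Plane) (i : Fin 2) (t : ℝ) (x : Plane) : ℝ :=
  deriv (fun s => X s x i) t

/-- `J ∂ξ_j / ∂t`, as a polynomial in the derivatives of the motion. -/
noncomputable def cofactorTime (X : ℝ → Plane → Plane) (j : Fin 2) (t : ℝ) (x : Plane) : ℝ :=
  -∑ i, cofactor X j i t x * velocity X i t x

/-- The matrix `A^j` in terms of the cofactors. -/
noncomputable def cofactorMatA (X : ℝ → Plane → Plane) (j : Fin 2) (t : ℝ) (x : Plane) :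
    Matrix (Fin 3) (Fin 3) ℝ :=
  !![cofactorTime X j t x, cofactor X j 0 t x,   cofactor X j 1 t x;
     cofactor X j 0 t x,   cofactorTime X j t x, 0;
     cofactor X j 1 t x,   0,                    cofactorTime X j t x]

theorem cofactor_zero_zero (X : ℝ → Plane → Plane) (t : ℝ) (x : Plane) :
    cofactor X 0 0 t x = pderiv 1 (fun y => X t y 1) x := by
  simp [cofactor, Matrix.adjugate_fin_two, jacMatrix]

theorem cofactor_zero_one (X : ℝ → Plane → Plane) (t : ℝ) (x : Plane) :
    cofactor X 0 1 t x = -pderiv 1 (fun y => X t y 0) x := by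
  simp [cofactor, Matrix.adjugate_fin_two, jacMatrix]

theorem cofactor_one_zero (X : ℝ → Plane → Plane) (t : ℝ) (x : Plane) :
    cofactor X 1 0 t x = -pderiv 0 (fun y => X t y 1) x := by
  simp [cofactor, Matrix.adjugate_fin_two, jacMatrix]

theorem cofactor_one_one (X : ℝ → Plane → Plane) (t : ℝ) (x : Plane) :
    cofactor X 1 1 t x = pderiv 0 (fun y => X t y 0) x := by
  simp [cofactor, Matrix.adjugate_fin_two, jacMatrix]

variable {X : ℝ → Plane → Plane} {t : ℝ} {x : Plane}

theorem dxidx_mul_jacDet (h : jacDet X t x ≠ 0) (j i : Fin 2) :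
    dxidx X j i t x * jacDet X t x = cofactor X j i t x := by
  have h' : (jacMatrix X t x).det ≠ 0 := h
  simp only [dxidx, jacDet, cofactor, Matrix.inv_def, Matrix.smul_apply, smul_eq_mul,
    Ring.inverse_eq_inv']
  field_simp

theorem dxidt_mul_jacDet (h : jacDet X t x ≠ 0) (j : Fin 2) :
    dxidt X j t x * jacDet X t x = cofactorTime X j t x := by
  simp only [dxidt, cofactorTime, velocity, ← dxidx_mul_jacDet h, neg_mul, Finset.sum_mul]
  congr 1
  exact Finset.sum_congr rfl fun i _ => by ring

theorem matA_eq (h : jacDet X t x ≠ 0) (j : Fin 2) : matA X j t x = cofactorMatA X j t x := by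
  simp only [matA, cofactorMatA, dxidx_mul_jacDet h, dxidt_mul_jacDet h]

theorem cofactorMatA_transpose (X : ℝ → Plane → Plane) (j : Fin 2) (t : ℝ) (x : Plane) :
    (cofactorMatA X j t x)ᵀ = cofactorMatA X j t x := by
  ext a b
  fin_cases a <;> fin_cases b <;> rfl

/-! ### Smoothness -/

theorem contDiff_pderiv {n : ℕ} {f : Plane → ℝ} (hf : ContDiff ℝ (n + 1 : ℕ) f) (j : Fin 2) :
    ContDiff ℝ n (pderiv j f) := by
  have h : ContDiff ℝ n (fderiv ℝ f) := hf.fderiv_right (by norm_cast)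
  exact h.clm_apply contDiff_const

theorem contDiff_motion {n : ℕ} (hX : ContDiff ℝ n fun z : ℝ × Plane => X z.1 z.2) (t : ℝ)
    (i : Fin 2) : ContDiff ℝ n fun y => X t y i :=
  ((EuclideanSpace.proj (𝕜 := ℝ) i).contDiff).comp (hX.comp (contDiff_const.prodMk contDiff_id))

theorem contDiff_cofactor {n : ℕ} (hX : ContDiff ℝ (n + 1 : ℕ) fun z : ℝ × Plane => X z.1 z.2)
    (j i : Fin 2) (t : ℝ) : ContDiff ℝ n (cofactor X j i t) := by
  have h := fun a b => contDiff_pderiv (contDiff_motion hX t a) b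
  match j, i with
  | 0, 0 => rw [funext (cofactor_zero_zero X t)]; exact h 1 1
  | 0, 1 => rw [funext (cofactor_zero_one X t)]; exact (h 0 1).neg
  | 1, 0 => rw [funext (cofactor_one_zero X t)]; exact (h 1 0).neg
  | 1, 1 => rw [funext (cofactor_one_one X t)]; exact h 0 0

theorem contDiff_velocity {n : ℕ} (hX : ContDiff ℝ (n + 1 : ℕ) fun z : ℝ × Plane => X z.1 z.2)
    (i : Fin 2) (t : ℝ) : ContDiff ℝ n (velocity X i t) := by
  set F : ℝ × Plane → ℝ := fun z => X z.1 z.2 i with hF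
  have hFs : ContDiff ℝ (n + 1 : ℕ) F := ((EuclideanSpace.proj (𝕜 := ℝ) i).contDiff).comp hX
  have hFd : ContDiff ℝ n (fderiv ℝ F) := hFs.fderiv_right (by norm_cast)
  have h : ∀ y, velocity X i t y = fderiv ℝ F (t, y) (1, 0) := by
    intro y
    have h1 : HasFDerivAt F (fderiv ℝ F (t, y)) (t, y) :=
      (hFs.differentiable (by norm_cast)).differentiableAt.hasFDerivAt
    have h2 : HasDerivAt (fun s : ℝ => (s, y)) ((1 : ℝ), (0 : Plane)) t :=
      (hasDerivAt_id t).prodMk (hasDerivAt_const t y)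
    exact (h1.comp_hasDerivAt t h2).deriv
  rw [funext h]
  exact (hFd.comp (contDiff_const.prodMk contDiff_id)).clm_apply contDiff_const

theorem contDiff_cofactorTime {n : ℕ}
    (hX : ContDiff ℝ (n + 1 : ℕ) fun z : ℝ × Plane => X z.1 z.2) (j : Fin 2) (t : ℝ) :
    ContDiff ℝ n (cofactorTime X j t) :=
  (ContDiff.sum fun i _ => (contDiff_cofactor hX j i t).mul (contDiff_velocity hX i t)).neg

theorem contDiff_cofactorMatA {n : ℕ}
    (hX : ContDiff ℝ (n + 1 : ℕ) fun z : ℝ × Plane => X z.1 z.2) (j : Fin 2) (t : ℝ)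
    (a b : Fin 3) : ContDiff ℝ n fun y => cofactorMatA X j t y a b := by
  have h1 := contDiff_cofactor hX j 0 t
  have h2 := contDiff_cofactor hX j 1 t
  have h3 := contDiff_cofactorTime hX j t
  fin_cases a <;> fin_cases b <;>
    first | exact h1 | exact h2 | exact h3 | exact contDiff_const

/-- Positivity of the Jacobian is assumed on closed elements only. Being nonzero is an open
condition, so the geometric factors agree with their smooth cofactor form near boundary points too,
and their derivatives can be compared there. -/
theorem eventually_jacDet_ne_zero (hX : ContDiff ℝ 2 fun z : ℝ × Plane => X z.1 z.2)
    (h : jacDet X t x ≠ 0) : ∀ᶠ y in 𝓝 x, jacDet X t y ≠ 0 := by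
  have hc : Continuous (jacDet X t) := by
    have h := fun a b => (contDiff_pderiv (n := 1) (contDiff_motion hX t a) b).continuous
    have : jacDet X t = fun y => pderiv 0 (fun y => X t y 0) y * pderiv 1 (fun y => X t y 1) y -
        pderiv 1 (fun y => X t y 0) y * pderiv 0 (fun y => X t y 1) y := by
      ext y
      simp [jacDet, Matrix.det_fin_two, jacMatrix]
    rw [this]
    exact ((h 0 0).mul (h 1 1)).sub ((h 0 1).mul (h 1 0))
  exact hc.continuousAt.eventually_ne h

theorem pderiv_congr {f g : Plane → ℝ} (h : f =ᶠ[𝓝 x] g) (j : Fin 2) :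
    pderiv j f x = pderiv j g x := by
  rw [pderiv, pderiv, h.fderiv_eq]

/-- The divergence `∇̂ · (J x̂_t)` in terms of the cofactors. -/
noncomputable def cofactorDiv (X : ℝ → Plane → Plane) (t : ℝ) (x : Plane) : ℝ :=
  ∑ j, pderiv j (cofactorTime X j t) x

theorem contDiff_cofactorDiv {n : ℕ}
    (hX : ContDiff ℝ (n + 2 : ℕ) fun z : ℝ × Plane => X z.1 z.2) (t : ℝ) :
    ContDiff ℝ n (cofactorDiv X t) :=
  ContDiff.sum fun j _ => contDiff_pderiv (contDiff_cofactorTime hX j t) j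

theorem geomDiv_eq (hX : ContDiff ℝ 2 fun z : ℝ × Plane => X z.1 z.2)
    (h : jacDet X t x ≠ 0) : geomDiv X t x = cofactorDiv X t x := by
  refine Finset.sum_congr rfl fun j _ => pderiv_congr ?_ j
  filter_upwards [eventually_jacDet_ne_zero hX h] with y hy
  rw [mul_comm, dxidt_mul_jacDet hy]

theorem geomDiv_eventuallyEq (hX : ContDiff ℝ 2 fun z : ℝ × Plane => X z.1 z.2)
    (h : jacDet X t x ≠ 0) : geomDiv X t =ᶠ[𝓝 x] cofactorDiv X t := by
  filter_upwards [eventually_jacDet_ne_zero hX h] with y hy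
  exact geomDiv_eq hX hy

theorem dmatA_eq (hX : ContDiff ℝ 2 fun z : ℝ × Plane => X z.1 z.2)
    (h : jacDet X t x ≠ 0) (j : Fin 2) (a b : Fin 3) :
    dmatA X j t x a b = pderiv j (fun y => cofactorMatA X j t y a b) x := by
  refine pderiv_congr ?_ j
  filter_upwards [eventually_jacDet_ne_zero hX h] with y hy
  rw [matA_eq hy]

/-! ### The metric identities -/

theorem pderiv_comm {f : Plane → ℝ} (hf : ContDiff ℝ 2 f) (i j : Fin 2) (x : Plane) :
    pderiv i (pderiv j f) x = pderiv j (pderiv i f) x := by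
  have hd : DifferentiableAt ℝ (fderiv ℝ f) x :=
    ((hf.fderiv_right (m := 1) (by norm_num)).differentiable (by simp)).differentiableAt
  have h : ∀ i j : Fin 2, pderiv i (pderiv j f) x =
      fderiv ℝ (fderiv ℝ f) x (EuclideanSpace.single i 1) (EuclideanSpace.single j 1) := by
    intro i j
    change fderiv ℝ (fun y => fderiv ℝ f y (EuclideanSpace.single j 1)) x _ = _
    rw [fderiv_clm_apply hd (differentiableAt_const _)]
    simp
  rw [h, h]
  exact (hf.contDiffAt.isSymmSndFDerivAt (by simp)).eq _ _

theorem pderiv_neg (j : Fin 2) (f : Plane → ℝ) (x : Plane) :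
    pderiv j (fun y => -f y) x = -pderiv j f x := by
  simp [pderiv, fderiv_fun_neg]

/-- The Piola identity: each cofactor is a signed first derivative of the motion, and mixed second
derivatives commute. -/
theorem sum_pderiv_cofactor (hX : ContDiff ℝ 2 fun z : ℝ × Plane => X z.1 z.2) (i : Fin 2)
    (t : ℝ) (x : Plane) : ∑ j, pderiv j (cofactor X j i t) x = 0 := by
  rw [Fin.sum_univ_two]
  fin_cases i
  · change pderiv 0 (cofactor X 0 0 t) x + pderiv 1 (cofactor X 1 0 t) x = 0
    rw [funext (cofactor_zero_zero X t), funext (cofactor_one_zero X t), pderiv_neg]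
    have := pderiv_comm (contDiff_motion (n := 2) hX t 1) 0 1 x
    exact add_neg_eq_zero.mpr this
  · change pderiv 0 (cofactor X 0 1 t) x + pderiv 1 (cofactor X 1 1 t) x = 0
    rw [funext (cofactor_zero_one X t), funext (cofactor_one_one X t), pderiv_neg]
    have := pderiv_comm (contDiff_motion (n := 2) hX t 0) 0 1 x
    exact neg_add_eq_zero.mpr this

/-- The Piola identity removes the off-diagonal entries; the diagonal ones are the geometric
divergence, the same quantity that drives the equation for `J`. -/
theorem sum_dmatA (hX : ContDiff ℝ 2 fun z : ℝ × Plane => X z.1 z.2) (h : jacDet X t x ≠ 0) :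
    ∑ j, dmatA X j t x = geomDiv X t x • (1 : Matrix (Fin 3) (Fin 3) ℝ) := by
  have h0 := sum_pderiv_cofactor hX 0 t x
  have h1 := sum_pderiv_cofactor hX 1 t x
  have h2 : ∑ j, pderiv j (cofactorTime X j t) x = geomDiv X t x := (geomDiv_eq hX h).symm
  have hz : ∀ j : Fin 2, pderiv j (fun _ => (0 : ℝ)) x = 0 := fun j => by simp [pderiv]
  rw [Fin.sum_univ_two] at h0 h1 h2
  ext a b
  rw [Matrix.sum_apply, Fin.sum_univ_two, dmatA_eq hX h, dmatA_eq hX h]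
  fin_cases a <;> fin_cases b <;>
    simp [cofactorMatA, hz] <;> first | exact h0 | exact h1 | exact h2

/-! ### The normal flux matrix -/

/-- `A_n` in terms of the cofactors. -/
noncomputable def cofactorMatAn (X : ℝ → Plane → Plane) (n : Fin 2 → ℝ) (t : ℝ) (x : Plane) :
    Matrix (Fin 3) (Fin 3) ℝ :=
  ∑ j, n j • cofactorMatA X j t x

theorem matAn_eq (h : jacDet X t x ≠ 0) (n : Fin 2 → ℝ) :
    matAn X n t x = cofactorMatAn X n t x := by
  simp only [matAn, cofactorMatAn, matA_eq h]

theorem cofactorMatAn_transpose (X : ℝ → Plane → Plane) (n : Fin 2 → ℝ) (t : ℝ) (x : Plane) :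
    (cofactorMatAn X n t x)ᵀ = cofactorMatAn X n t x := by
  simp only [cofactorMatAn, Matrix.transpose_sum, Matrix.transpose_smul, cofactorMatA_transpose]

theorem cofactorMatAn_smul (X : ℝ → Plane → Plane) (r : ℝ) (n : Fin 2 → ℝ) (t : ℝ) (x : Plane) :
    cofactorMatAn X (r • n) t x = r • cofactorMatAn X n t x := by
  simp only [cofactorMatAn, Finset.smul_sum, Pi.smul_apply, smul_assoc]

theorem continuous_cofactorMatAn (hX : ContDiff ℝ 1 fun z : ℝ × Plane => X z.1 z.2)
    (n : Fin 2 → ℝ) (t : ℝ) (a b : Fin 3) : Continuous fun y => cofactorMatAn X n t y a b := by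
  simp only [cofactorMatAn, Matrix.sum_apply, Matrix.smul_apply, smul_eq_mul]
  exact continuous_finsetSum _ fun j _ =>
    continuous_const.mul (contDiff_cofactorMatA (n := 0) hX j t a b).continuous

theorem fderiv_apply_eq_pderiv (f : Plane → ℝ) (x u : Plane) :
    fderiv ℝ f x u = u 0 * pderiv 0 f x + u 1 * pderiv 1 f x := by
  have : u = u 0 • EuclideanSpace.single 0 (1 : ℝ) + u 1 • EuclideanSpace.single 1 (1 : ℝ) := by
    ext i; fin_cases i <;> simp
  conv_lhs => rw [this]
  simp [pderiv]

/-- The normal flux matrix for the normal obtained by turning `u` depends only on the velocity and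
the derivatives of the motion in the direction `u`. -/
theorem cofactorMatAn_congr {Y : ℝ → Plane → Plane} {u : Plane}
    (hv : ∀ i, velocity X i t x = velocity Y i t x)
    (hu : ∀ i, fderiv ℝ (fun y => X t y i) x u = fderiv ℝ (fun y => Y t y i) x u) :
    cofactorMatAn X ![u 1, -u 0] t x = cofactorMatAn Y ![u 1, -u 0] t x := by
  have hc : ∀ i, u 1 * cofactor X 0 i t x + -u 0 * cofactor X 1 i t x =
      u 1 * cofactor Y 0 i t x + -u 0 * cofactor Y 1 i t x := by
    intro i
    have h0 := hu 0
    have h1 := hu 1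
    simp only [fderiv_apply_eq_pderiv] at h0 h1
    match i with
    | 0 => rw [cofactor_zero_zero, cofactor_one_zero, cofactor_zero_zero, cofactor_one_zero]; linarith
    | 1 => rw [cofactor_zero_one, cofactor_one_one, cofactor_zero_one, cofactor_one_one]; linarith
  have ht : u 1 * cofactorTime X 0 t x + -u 0 * cofactorTime X 1 t x =
      u 1 * cofactorTime Y 0 t x + -u 0 * cofactorTime Y 1 t x := by
    simp only [cofactorTime, Fin.sum_univ_two, hv]
    linear_combination (-velocity Y 0 t x) * hc 0 - velocity Y 1 t x * hc 1
  have h0 := hc 0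
  have h1 := hc 1
  ext a b
  simp only [cofactorMatAn, Fin.sum_univ_two, Matrix.add_apply, Matrix.smul_apply, smul_eq_mul,
    Matrix.cons_val_zero, Matrix.cons_val_one]
  fin_cases a <;> fin_cases b <;>
    simp only [cofactorMatA, Fin.zero_eta, Fin.mk_one, Fin.reduceFinMk, Matrix.of_apply,
      Matrix.cons_val] <;>
    first | exact h0 | exact h1 | exact ht

end

section

/-! ### Adjacent triangles -/

/-- The affine function that vanishes on the line through `a` and `b`. -/
def side (a b x : Plane) : ℝ := (b 1 - a 1) * (x 0 - a 0) + -(b 0 - a 0) * (x 1 - a 1)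

theorem side_left (a b : Plane) : side a b a = 0 := by simp [side]

theorem side_right (a b : Plane) : side a b b = 0 := by simp [side]; ring

theorem side_swap (a b x : Plane) : side b a x = -side a b x := by simp [side]; ring

theorem convex_side_eq_zero (a b : Plane) : Convex ℝ {x | side a b x = 0} := by
  intro x hx y hy s t _ _ hst
  simp only [mem_ofPred_eq, side] at hx hy ⊢
  simp only [PiLp.add_apply, PiLp.smul_apply, smul_eq_mul]
  obtain rfl : t = 1 - s := by linarith
  linear_combination s * hx + (1 - s) * hy

theorem fin_three_add_ne : ∀ i : Fin 3, i + 1 ≠ i ∧ i + 2 ≠ i ∧ i + 1 ≠ i + 2 := by decide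

theorem side_ne_zero {v : Fin 3 → Plane} (hv : AffineIndependent ℝ v) (i : Fin 3) :
    side (v (i + 1)) (v (i + 2)) (v i) ≠ 0 := by
  intro h
  have hne : v (i + 1) ≠ v (i + 2) := hv.injective.ne (fin_three_add_ne i).2.2
  set a := v (i + 1) with ha
  set b := v (i + 2) with hb
  set c := v i with hc
  -- If `c` lies on the line, it equals its own projection `a + (r / s) (b - a)`; clearing
  -- denominators gives an affine dependence with weights `s`, `r - s`, `-r`.
  let s : ℝ := (b 0 - a 0) ^ 2 + (b 1 - a 1) ^ 2
  let r : ℝ := (b 0 - a 0) * (c 0 - a 0) + (b 1 - a 1) * (c 1 - a 1)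
  let w : Fin 3 → ℝ := fun j => if j = i then s else if j = i + 1 then r - s else -r
  have hw0 : w i = s := by simp [w]
  have hw1 : w (i + 1) = r - s := by simp [w]
  have hw2 : w (i + 2) = -r := by
    simp [w, (fin_three_add_ne i).2.1]
  have hsum : ∀ {α : Type} [AddCommMonoid α] (f : Fin 3 → α),
      ∑ j, f j = f i + f (i + 1) + f (i + 2) := by
    intro α _ f
    rw [Fin.sum_univ_three]
    match i with
    | 0 => rfl
    | 1 => change _ = f 1 + f 2 + f 0; abel
    | 2 => change _ = f 2 + f 0 + f 1; abel
  have key := (affineIndependent_iff.mp hv) Finset.univ w (by rw [hsum w, hw0, hw1, hw2]; ring) (by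
    rw [hsum, hw0, hw1, hw2, ← ha, ← hb, ← hc]
    have h' : (b 1 - a 1) * (c 0 - a 0) + -(b 0 - a 0) * (c 1 - a 1) = 0 := h
    ext j
    simp only [PiLp.add_apply, PiLp.smul_apply, smul_eq_mul, PiLp.zero_apply, s, r]
    match j with
    | 0 => linear_combination (b 1 - a 1) * h'
    | 1 => linear_combination (-(b 0 - a 0)) * h') i (Finset.mem_univ i)
  rw [hw0] at key
  have h0 : b 0 - a 0 = 0 := by nlinarith [sq_nonneg (b 0 - a 0), sq_nonneg (b 1 - a 1)]
  have h1 : b 1 - a 1 = 0 := by nlinarith [sq_nonneg (b 0 - a 0), sq_nonneg (b 1 - a 1)]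
  apply hne
  ext j
  match j with
  | 0 => linarith
  | 1 => linarith

/-- Two triangles on the same side of a common edge intersect outside of the edge. -/
theorem exists_mem_inter_of_same_side {a b c c' : Plane} (h : 0 < side a b c * side a b c') :
    ∃ x, x ∈ convexHull ℝ {a, b, c} ∧ x ∈ convexHull ℝ {a, b, c'} ∧ side a b x ≠ 0 := by
  have hc : side a b c ≠ 0 := left_ne_zero_of_mul h.ne'
  have hc' : side a b c' ≠ 0 := right_ne_zero_of_mul h.ne'
  -- `α`, `β`, `γ` are the barycentric coordinates of `c'` with respect to `a`, `b`, `c`; being on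
  -- the same side means `γ > 0`.
  set γ := side a b c' / side a b c with hγ
  have hγpos : 0 < γ := by
    rw [hγ, div_eq_mul_inv, ← mul_pos_iff_of_pos_right (sq_pos_of_ne_zero hc)]
    have : side a b c' * (side a b c)⁻¹ * side a b c ^ 2 = side a b c * side a b c' := by
      field_simp
    rw [this]; exact h
  set β := ((c' 1 - a 1) * (c 0 - a 0) - (c' 0 - a 0) * (c 1 - a 1)) / side a b c with hβ
  set α := 1 - β - γ with hα
  have hcomb : c' = α • a + β • b + γ • c := by
    ext j
    simp only [PiLp.add_apply, PiLp.smul_apply, smul_eq_mul, hα, hβ, hγ]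
    field_simp
    match j with
    | 0 => simp only [side]; ring
    | 1 => simp only [side]; ring
  -- The common point is the midpoint of the edge moved towards `c'` by a fraction `ε`, small enough
  -- to keep all its coordinates in both triangles nonnegative.
  set ε : ℝ := 1 / (2 + 2 * |α| + 2 * |β|) with hε
  have hden : 0 < 2 + 2 * |α| + 2 * |β| := by positivity
  have hεpos : 0 < ε := by positivity
  have hε1 : ε * (2 + 2 * |α| + 2 * |β|) = 1 := by rw [hε]; field_simp
  have hεα : 0 ≤ ε * |α| := by positivity
  have hεβ : 0 ≤ ε * |β| := by positivity
  have hεα' : -(ε * |α|) ≤ ε * α := by nlinarith [neg_abs_le α]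
  have hεβ' : -(ε * |β|) ≤ ε * β := by nlinarith [neg_abs_le β]
  have hull : ∀ (d : Plane) (r s t : ℝ), 0 ≤ r → 0 ≤ s → 0 ≤ t → r + s + t = 1 →
      r • a + s • b + t • d ∈ convexHull ℝ {a, b, d} := by
    intro d r s t hr hs ht hrst
    have := (convex_convexHull ℝ {a, b, d}).sum_mem (t := Finset.univ) (w := ![r, s, t])
      (z := ![a, b, d]) (by intro i _; fin_cases i <;> simpa) (by simp [Fin.sum_univ_three, hrst])
      (by intro i _; apply subset_convexHull; fin_cases i <;> simp)
    simpa [Fin.sum_univ_three] using this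
  refine ⟨((1 - ε) / 2) • a + ((1 - ε) / 2) • b + ε • c', ?_, ?_, ?_⟩
  · have h1 : ((1 - ε) / 2) • a + ((1 - ε) / 2) • b + ε • c' =
        ((1 - ε) / 2 + ε * α) • a + ((1 - ε) / 2 + ε * β) • b + (ε * γ) • c := by
      rw [hcomb]; module
    rw [h1]
    refine hull c _ _ _ ?_ ?_ (by positivity) ?_
    · nlinarith
    · nlinarith
    · rw [hα]; ring
  · refine hull c' _ _ _ ?_ ?_ hεpos.le (by ring) <;> nlinarith
  · have h1 : side a b (((1 - ε) / 2) • a + ((1 - ε) / 2) • b + ε • c') = ε * side a b c' := by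
      simp only [side, PiLp.add_apply, PiLp.smul_apply, smul_eq_mul]
      ring
    rw [h1]
    exact mul_ne_zero hεpos.ne' hc'

/-! ### Shared edges: uniqueness of the neighbor, opposite normals, equal edge integrals. -/

namespace TriMesh

variable {K : ℕ} (M : TriMesh K)

/-- `e` and `f` are the same edge, seen from two different triangles. -/
def SameEdge (e f : Fin K × Fin 3) : Prop :=
  f.1 ≠ e.1 ∧
    ((M.edgeStart f.1 f.2 = M.edgeStart e.1 e.2 ∧ M.edgeEnd f.1 f.2 = M.edgeEnd e.1 e.2) ∨
     (M.edgeStart f.1 f.2 = M.edgeEnd e.1 e.2 ∧ M.edgeEnd f.1 f.2 = M.edgeStart e.1 e.2))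

variable {M}

theorem SameEdge.symm {e f : Fin K × Fin 3} (h : M.SameEdge e f) : M.SameEdge f e := by
  obtain ⟨hne, h | h⟩ := h
  · exact ⟨hne.symm, Or.inl ⟨h.1.symm, h.2.symm⟩⟩
  · exact ⟨hne.symm, Or.inr ⟨h.2.symm, h.1.symm⟩⟩

theorem vert_injective (M : TriMesh K) (k : Fin K) : Function.Injective (M.vert k) :=
  (M.indep k).injective

theorem range_vert (M : TriMesh K) (k : Fin K) (i : Fin 3) :
    range (M.vert k) = {M.edgeStart k i, M.edgeEnd k i, M.vert k i} := by
  have h : ∀ j : Fin 3, j = i + 1 ∨ j = i + 2 ∨ j = i := by revert i; decide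
  ext x
  constructor
  · rintro ⟨j, rfl⟩
    rcases h j with rfl | rfl | rfl <;> simp [edgeStart, edgeEnd]
  · rintro (rfl | rfl | rfl)
    · exact ⟨_, rfl⟩
    · exact ⟨_, rfl⟩
    · exact ⟨_, rfl⟩

theorem isNeighbor_iff (M : TriMesh K) (k : Fin K) (i : Fin 3) (l : Fin K) :
    M.IsNeighbor k i l ↔ ∃ j, M.SameEdge (k, i) (l, j) := by
  constructor
  · rintro ⟨hne, h⟩
    obtain ⟨j₁, h₁⟩ := h (i + 1) (fin_three_add_ne i).1
    obtain ⟨j₂, h₂⟩ := h (i + 2) (fin_three_add_ne i).2.1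
    have hj : j₁ ≠ j₂ := by
      rintro rfl
      exact (fin_three_add_ne i).2.2 (M.vert_injective k (h₁.symm.trans h₂))
    have hd : ∀ j₁ j₂ : Fin 3, j₁ ≠ j₂ →
        ∃ j : Fin 3, (j + 1 = j₁ ∧ j + 2 = j₂) ∨ (j + 1 = j₂ ∧ j + 2 = j₁) := by decide
    obtain ⟨j, ⟨rfl, rfl⟩ | ⟨rfl, rfl⟩⟩ := hd j₁ j₂ hj
    · exact ⟨j, hne, Or.inl ⟨h₁, h₂⟩⟩
    · exact ⟨j, hne, Or.inr ⟨h₂, h₁⟩⟩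
  · rintro ⟨j, hne, h⟩
    refine ⟨hne, fun m hm => ?_⟩
    have hd : ∀ m i : Fin 3, m ≠ i → m = i + 1 ∨ m = i + 2 := by decide
    rcases hd m i hm with rfl | rfl <;> rcases h with h | h
    · exact ⟨_, h.1⟩
    · exact ⟨_, h.2⟩
    · exact ⟨_, h.2⟩
    · exact ⟨_, h.1⟩

/-- Triangles with a common edge lie on opposite sides of it. -/
theorem SameEdge.side_mul_neg {e f : Fin K × Fin 3} (h : M.SameEdge e f) :
    side (M.edgeStart e.1 e.2) (M.edgeEnd e.1 e.2) (M.vert e.1 e.2) *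
      side (M.edgeStart e.1 e.2) (M.edgeEnd e.1 e.2) (M.vert f.1 f.2) < 0 := by
  obtain ⟨k, i⟩ := e
  obtain ⟨l, j⟩ := f
  have hk := side_ne_zero (M.indep k) i
  have hl := side_ne_zero (M.indep l) j
  have hrl : range (M.vert l) = {M.edgeStart k i, M.edgeEnd k i, M.vert l j} := by
    rw [M.range_vert l j]
    rcases h.2 with h' | h'
    · rw [h'.1, h'.2]
    · rw [h'.1, h'.2, insert_comm]
  have hrk := M.range_vert k i
  change side (M.edgeStart k i) (M.edgeEnd k i) (M.vert k i) ≠ 0 at hk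
  have hl' : side (M.edgeStart k i) (M.edgeEnd k i) (M.vert l j) ≠ 0 := by
    change side (M.edgeStart l j) (M.edgeEnd l j) (M.vert l j) ≠ 0 at hl
    rcases h.2 with h' | h'
    · rwa [h'.1, h'.2] at hl
    · rw [h'.1, h'.2, side_swap] at hl
      exact neg_ne_zero.mp hl
  by_contra hcon
  have hpos := lt_of_le_of_ne (not_lt.mp hcon) (mul_ne_zero hk hl').symm
  obtain ⟨x, hx1, hx2, hx3⟩ := exists_mem_inter_of_same_side hpos
  rw [← hrk] at hx1
  rw [← hrl] at hx2
  have hx := M.inter k l ⟨hx1, hx2⟩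
  -- By conformity the overlap lies in the hull of the common vertices. These are on the edge line,
  -- unless the opposite vertices coincide, which would make the triangles equal.
  refine hx3 (convexHull_min ?_ (convex_side_eq_zero _ _) hx)
  rintro y ⟨hy1, hy2⟩
  rw [hrk] at hy1
  rcases hy1 with rfl | rfl | rfl
  · exact side_left _ _
  · exact side_right _ _
  · rw [hrl] at hy2
    rcases hy2 with hy | hy | hy
    · rw [hy] at hk; exact absurd (side_left _ _) hk
    · rw [hy] at hk; exact absurd (side_right _ _) hk
    · refine absurd (M.inj k l ?_).symm h.1
      rw [hrk, hrl, show M.vert k i = M.vert l j from hy]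

/-- Three distinct triangles with a common edge would lie pairwise on opposite sides of it; the
product of the three negative side products is a square. -/
theorem SameEdge.unique {e f g : Fin K × Fin 3} (hf : M.SameEdge e f) (hg : M.SameEdge e g) :
    f = g := by
  by_cases hfg : g.1 = f.1
  · obtain ⟨l, j⟩ := f
    obtain ⟨l', j'⟩ := g
    obtain rfl : l' = l := hfg
    have hinj := M.vert_injective l'
    have hd : ∀ j j' : Fin 3, (j + 1 = j' + 1 ∧ j + 2 = j' + 2) ∨ (j + 1 = j' + 2 ∧ j + 2 = j' + 1) →
        j = j' := by decide
    have : j = j' := by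
      apply hd
      rcases hf.2 with h1 | h1 <;> rcases hg.2 with h2 | h2
      · exact Or.inl ⟨hinj (h1.1.trans h2.1.symm), hinj (h1.2.trans h2.2.symm)⟩
      · exact Or.inr ⟨hinj (h1.1.trans h2.2.symm), hinj (h1.2.trans h2.1.symm)⟩
      · exact Or.inr ⟨hinj (h1.1.trans h2.2.symm), hinj (h1.2.trans h2.1.symm)⟩
      · exact Or.inl ⟨hinj (h1.1.trans h2.1.symm), hinj (h1.2.trans h2.2.symm)⟩
    rw [this]
  · exfalso
    have h1 := hf.side_mul_neg
    have h2 := hg.side_mul_neg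
    have h3 : side (M.edgeStart e.1 e.2) (M.edgeEnd e.1 e.2) (M.vert f.1 f.2) *
        side (M.edgeStart e.1 e.2) (M.edgeEnd e.1 e.2) (M.vert g.1 g.2) < 0 := by
      rcases hf.2 with hf' | hf'
      · have hfg' : M.SameEdge f g := ⟨hfg, by rw [hf'.1, hf'.2]; exact hg.2⟩
        have := hfg'.side_mul_neg
        rwa [hf'.1, hf'.2] at this
      · have hfg' : M.SameEdge f g := ⟨hfg, by rw [hf'.1, hf'.2]; exact hg.2.symm⟩
        have := hfg'.side_mul_neg
        rwa [hf'.1, hf'.2, side_swap, side_swap _ _ (M.vert g.1 g.2), neg_mul_neg] at this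
    set A := side (M.edgeStart e.1 e.2) (M.edgeEnd e.1 e.2) (M.vert e.1 e.2)
    set B := side (M.edgeStart e.1 e.2) (M.edgeEnd e.1 e.2) (M.vert f.1 f.2)
    set C := side (M.edgeStart e.1 e.2) (M.edgeEnd e.1 e.2) (M.vert g.1 g.2)
    have h4 := mul_neg_of_pos_of_neg (mul_pos_of_neg_of_neg h1 h2) h3
    nlinarith [sq_nonneg (A * B * C)]

theorem isInterior_iff (M : TriMesh K) (e : Fin K × Fin 3) :
    M.IsInterior e.1 e.2 ↔ ∃ f, M.SameEdge e f := by
  simp only [IsInterior, isNeighbor_iff]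
  exact ⟨fun ⟨l, j, h⟩ => ⟨(l, j), h⟩, fun ⟨⟨l, j⟩, h⟩ => ⟨l, j, h⟩⟩

/-- Uniqueness of the neighbor makes the choice in the exterior trace irrelevant. -/
theorem SameEdge.extTrace_eq {e f : Fin K × Fin 3} (h : M.SameEdge e f)
    (q : Fin K → Plane → Fin 3 → ℝ) (x : Plane) : M.extTrace q e.1 e.2 x = q f.1 x := by
  have hint : M.IsInterior e.1 e.2 := (M.isInterior_iff e).mpr ⟨f, h⟩
  rw [extTrace, dif_pos hint]
  obtain ⟨j, hj⟩ := (M.isNeighbor_iff _ _ _).mp hint.choose_spec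
  rw [h.unique hj]

theorem normal_eq (M : TriMesh K) (k : Fin K) (i : Fin 3) : M.normal k i =
    (-(Real.sign (side (M.edgeStart k i) (M.edgeEnd k i) (M.vert k i))) /
      dist (M.edgeStart k i) (M.edgeEnd k i)) •
    ![(M.edgeEnd k i - M.edgeStart k i) 1, -(M.edgeEnd k i - M.edgeStart k i) 0] := rfl

theorem SameEdge.normal_eq_neg {e f : Fin K × Fin 3} (h : M.SameEdge e f) :
    M.normal f.1 f.2 = -M.normal e.1 e.2 := by
  have hs : Real.sign (side (M.edgeStart e.1 e.2) (M.edgeEnd e.1 e.2) (M.vert f.1 f.2)) =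
      -Real.sign (side (M.edgeStart e.1 e.2) (M.edgeEnd e.1 e.2) (M.vert e.1 e.2)) := by
    rcases mul_neg_iff.mp h.side_mul_neg with ⟨h1, h2⟩ | ⟨h1, h2⟩
    · rw [Real.sign_of_pos h1, Real.sign_of_neg h2]
    · rw [Real.sign_of_pos h2, Real.sign_of_neg h1, neg_neg]
  rw [normal_eq, normal_eq]
  rcases h.2 with h' | h'
  · rw [h'.1, h'.2, hs, ← neg_smul, neg_div]
  · rw [h'.1, h'.2, side_swap, Real.sign_neg, hs, dist_comm (M.edgeEnd e.1 e.2)]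
    ext m
    match m with
    | 0 => simp; ring
    | 1 => simp; ring

theorem lineMap_mem_elem (M : TriMesh K) (k : Fin K) (i : Fin 3) {s : ℝ} (hs : s ∈ Icc (0 : ℝ) 1) :
    AffineMap.lineMap (M.edgeStart k i) (M.edgeEnd k i) s ∈ M.elem k :=
  (convex_convexHull ℝ _).lineMap_mem
    (subset_convexHull ℝ (range (M.vert k)) (mem_range_self (i + 1)))
    (subset_convexHull ℝ (range (M.vert k)) (mem_range_self (i + 2))) hs

theorem SameEdge.lineMap_mem_elem {e f : Fin K × Fin 3} (h : M.SameEdge e f) {s : ℝ}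
    (hs : s ∈ Icc (0 : ℝ) 1) :
    AffineMap.lineMap (M.edgeStart e.1 e.2) (M.edgeEnd e.1 e.2) s ∈ M.elem f.1 := by
  rcases h.2 with h' | h'
  · rw [← h'.1, ← h'.2]
    exact M.lineMap_mem_elem _ _ hs
  · rw [← h'.1, ← h'.2, ← AffineMap.lineMap_apply_one_sub]
    exact M.lineMap_mem_elem f.1 f.2 (s := 1 - s) ⟨by linarith [hs.2], by linarith [hs.1]⟩

theorem SameEdge.edgeIntegral_eq {e f : Fin K × Fin 3} (h : M.SameEdge e f) (g : Plane → ℝ) :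
    M.edgeIntegral f.1 f.2 g = M.edgeIntegral e.1 e.2 g := by
  rw [edgeIntegral, edgeIntegral]
  rcases h.2 with h' | h'
  · rw [h'.1, h'.2]
  · rw [h'.1, h'.2, dist_comm]
    congr 1
    have := intervalIntegral.integral_comp_sub_left (a := 0) (b := 1) (fun s : ℝ =>
      g (AffineMap.lineMap (M.edgeStart e.1 e.2) (M.edgeEnd e.1 e.2) s)) 1
    simp only [sub_self, sub_zero, AffineMap.lineMap_apply_one_sub] at this
    exact this

theorem edgeIntegral_congr (M : TriMesh K) {k : Fin K} {i : Fin 3} {g g' : Plane → ℝ}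
    (h : ∀ s ∈ Icc (0 : ℝ) 1, g (AffineMap.lineMap (M.edgeStart k i) (M.edgeEnd k i) s) =
      g' (AffineMap.lineMap (M.edgeStart k i) (M.edgeEnd k i) s)) :
    M.edgeIntegral k i g = M.edgeIntegral k i g' := by
  rw [edgeIntegral, edgeIntegral]
  congr 1
  refine intervalIntegral.integral_congr fun s hs => ?_
  rw [uIcc_of_le zero_le_one] at hs
  exact h s hs

theorem edgeIntegral_add (M : TriMesh K) {k : Fin K} {i : Fin 3} {g g' : Plane → ℝ}
    (hg : Continuous g) (hg' : Continuous g') :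
    M.edgeIntegral k i (fun x => g x + g' x) = M.edgeIntegral k i g + M.edgeIntegral k i g' := by
  have hl : Continuous fun s : ℝ => (AffineMap.lineMap (M.edgeStart k i) (M.edgeEnd k i) s : Plane) :=
    AffineMap.lineMap_continuous
  rw [edgeIntegral, edgeIntegral, edgeIntegral, ← mul_add]
  congr 1
  exact intervalIntegral.integral_add ((hg.comp hl).intervalIntegrable 0 1)
    ((hg'.comp hl).intervalIntegrable 0 1)

theorem edgeIntegral_const_mul (M : TriMesh K) {k : Fin K} {i : Fin 3} (r : ℝ) (g : Plane → ℝ) :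
    M.edgeIntegral k i (fun x => r * g x) = r * M.edgeIntegral k i g := by
  rw [edgeIntegral, edgeIntegral, intervalIntegral.integral_const_mul]
  ring

end TriMesh

end

section

/-! ### The numerical flux -/

/-- End points are included: motions of adjacent elements are compared only on the closed time
interval and on the closed edge, not beyond. -/
theorem HasDerivAt.unique_of_eqOn_Icc {f g : ℝ → ℝ} {f' g' a b s : ℝ} (hf : HasDerivAt f f' s)
    (hg : HasDerivAt g g' s) (hab : a < b) (hs : s ∈ Icc a b) (h : EqOn f g (Icc a b)) :
    f' = g' := by
  have h1 := (hg.hasDerivWithinAt (s := Icc a b)).congr h (h hs)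
  exact (uniqueDiffOn_Icc hab s hs).eq_deriv _ hf.hasDerivWithinAt h1

/-- Sums over the edges of all triangles, rearranged as sums over the faces. -/
theorem sum_eq_sum_faces {ι : Type*} [Fintype ι] {P : ι → ι → Prop} {I : ι → Prop}
    [DecidablePred I] (hI : ∀ e, I e ↔ ∃ f, P e f) (hsymm : ∀ e f, P e f → P f e)
    (huniq : ∀ e f g, P e f → P e g → f = g) {F G : ι → ℝ}
    (hint : ∀ e f, P e f → F e + F f = G e) (hbd : ∀ e, ¬I e → F e = G e) :
    ∑ e, F e = ∑ e, (if I e then (1 / 2 : ℝ) else 1) * G e := by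
  classical
  -- The involution that swaps the two sides of an interior face and fixes boundary edges;
  -- symmetrizing the sum under it pairs the contributions.
  let σ : ι → ι := fun e => if h : ∃ f, P e f then h.choose else e
  have hσ : ∀ e f, P e f → σ e = f := fun e f h => by
    have h' : ∃ f, P e f := ⟨f, h⟩
    simp only [σ, dif_pos h']
    exact huniq e _ _ h'.choose_spec h
  have hσ' : ∀ e, ¬I e → σ e = e := fun e h => by
    simp only [σ]
    rw [dif_neg (mt (hI e).mpr h)]
  have hinv : Function.Involutive σ := by
    intro e
    by_cases h : I e
    · obtain ⟨f, hf⟩ := (hI e).mp h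
      rw [hσ e f hf, hσ f e (hsymm e f hf)]
    · rw [hσ' e h, hσ' e h]
  have h1 : ∑ e, F (σ e) = ∑ e, F e := Equiv.sum_comp hinv.toPerm F
  have h2 : ∑ e, (F e + F (σ e)) = ∑ e, 2 * ((if I e then (1 / 2 : ℝ) else 1) * G e) := by
    refine Finset.sum_congr rfl fun e _ => ?_
    by_cases h : I e
    · obtain ⟨f, hf⟩ := (hI e).mp h
      rw [hσ e f hf, hint e f hf, if_pos h]
      ring
    · rw [hσ' e h, hbd e h, if_neg h]
      ring
  rw [Finset.sum_add_distrib, h1, ← Finset.mul_sum] at h2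
  linarith

/-- The two sides of an interior face see `A` and `-A`. Symmetry of `A` cancels the central parts `w
⬝ᵥ A u` and `u ⬝ᵥ A w`, and only the squared length of `A (w - u)` is left. -/
theorem penalty_flux_add {A : Matrix (Fin 3) (Fin 3) ℝ} (hA : Aᵀ = A) (τ : ℝ) (u w : Fin 3 → ℝ) :
    (w - τ • (A *ᵥ (w - u))) ⬝ᵥ (A *ᵥ u) + (u - τ • (-A *ᵥ (u - w))) ⬝ᵥ (-A *ᵥ w) =
      τ * ((w - u) ⬝ᵥ ((Aᵀ * A) *ᵥ (w - u))) := by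
  have h1 : u ⬝ᵥ (A *ᵥ w) = w ⬝ᵥ (A *ᵥ u) := by
    rw [Matrix.dotProduct_mulVec, ← Matrix.mulVec_transpose, hA, dotProduct_comm]
  have h2 : (w - u) ⬝ᵥ ((Aᵀ * A) *ᵥ (w - u)) = (A *ᵥ (w - u)) ⬝ᵥ (A *ᵥ (w - u)) := by
    rw [← Matrix.mulVec_mulVec, Matrix.dotProduct_mulVec, ← Matrix.mulVec_transpose,
      Matrix.transpose_transpose]
  rw [h2]
  simp only [Matrix.neg_mulVec, Matrix.mulVec_sub, sub_dotProduct, dotProduct_sub, smul_dotProduct,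
    dotProduct_neg, neg_dotProduct, smul_neg, smul_sub, smul_eq_mul, h1]
  ring

theorem penalty_flux_boundary {A : Matrix (Fin 3) (Fin 3) ℝ} (τ : ℝ) (u : Fin 3 → ℝ) :
    ((0 : Fin 3 → ℝ) - τ • (A *ᵥ (0 - u))) ⬝ᵥ (A *ᵥ u) =
      τ * ((0 - u) ⬝ᵥ ((Aᵀ * A) *ᵥ (0 - u))) := by
  have h2 : (0 - u) ⬝ᵥ ((Aᵀ * A) *ᵥ (0 - u)) = (A *ᵥ (0 - u)) ⬝ᵥ (A *ᵥ (0 - u)) := by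
    rw [← Matrix.mulVec_mulVec, Matrix.dotProduct_mulVec, ← Matrix.mulVec_transpose,
      Matrix.transpose_transpose]
  rw [h2]
  simp [Matrix.mulVec_neg]

variable {K : ℕ} {M : TriMesh K} {T : ℝ} {X : Fin K → ℝ → Plane → Plane} {m : ℕ}

/-- The normal flux matrices of two adjacent triangles are opposite on their common edge. -/
theorem cofactorMatAn_neighbor (hX : IsMeshMotion M T m X) (hm : 1 ≤ m) (hT : 0 < T)
    {e f : Fin K × Fin 3} (h : M.SameEdge e f) {t : ℝ} (ht : t ∈ Icc 0 T) {s : ℝ}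
    (hs : s ∈ Icc (0 : ℝ) 1) :
    cofactorMatAn (X f.1) (M.normal f.1 f.2) t
        (AffineMap.lineMap (M.edgeStart e.1 e.2) (M.edgeEnd e.1 e.2) s) =
      -cofactorMatAn (X e.1) (M.normal e.1 e.2) t
        (AffineMap.lineMap (M.edgeStart e.1 e.2) (M.edgeEnd e.1 e.2) s) := by
  set a := M.edgeStart e.1 e.2 with ha
  set b := M.edgeEnd e.1 e.2 with hb
  have hmem : ∀ r ∈ Icc (0 : ℝ) 1, AffineMap.lineMap a b r ∈ M.elem e.1 ∩ M.elem f.1 :=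
    fun r hr => ⟨M.lineMap_mem_elem _ _ hr, h.lineMap_mem_elem hr⟩
  have hsm : ∀ (k : Fin K) (i : Fin 2), Differentiable ℝ fun z : ℝ × Plane => X k z.1 z.2 i :=
    fun k i => (((EuclideanSpace.proj (𝕜 := ℝ) i).contDiff).comp (hX.smooth k)).differentiable
      (by simp; omega)
  -- The motions agree at this point for all times in the interval and, at time `t`, along the whole
  -- edge. Differentiating these identities matches velocities and tangential derivatives; normal
  -- derivatives may differ.
  have hvel : ∀ i, velocity (X e.1) i t (AffineMap.lineMap a b s) =
      velocity (X f.1) i t (AffineMap.lineMap a b s) := by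
    intro i
    have hd : ∀ k, DifferentiableAt ℝ (fun r => X k r (AffineMap.lineMap a b s) i) t := fun k =>
      ((hsm k i).comp (differentiable_id.prodMk (differentiable_const _))).differentiableAt
    refine HasDerivAt.unique_of_eqOn_Icc (hd e.1).hasDerivAt (hd f.1).hasDerivAt hT ht ?_
    intro r hr
    change X e.1 r _ i = X f.1 r _ i
    rw [hX.compat e.1 f.1 r hr _ (hmem s hs)]
  have htan : ∀ i, fderiv ℝ (fun y => X e.1 t y i) (AffineMap.lineMap a b s) (b - a) =
      fderiv ℝ (fun y => X f.1 t y i) (AffineMap.lineMap a b s) (b - a) := by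
    intro i
    have hd : ∀ k, HasDerivAt (fun r => X k t (AffineMap.lineMap a b r) i)
        (fderiv ℝ (fun y => X k t y i) (AffineMap.lineMap a b s) (b - a)) s := fun k => by
      have h1 : DifferentiableAt ℝ (fun y => X k t y i) (AffineMap.lineMap a b s) :=
        ((hsm k i).comp ((differentiable_const t).prodMk differentiable_id)).differentiableAt
      exact h1.hasFDerivAt.comp_hasDerivAt s AffineMap.hasDerivAt_lineMap
    refine HasDerivAt.unique_of_eqOn_Icc (hd e.1) (hd f.1) zero_lt_one hs ?_
    intro r hr
    change X e.1 t _ i = X f.1 t _ i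
    rw [hX.compat e.1 f.1 t ht _ (hmem r hr)]
  rw [h.normal_eq_neg, ← neg_one_smul ℝ (M.normal e.1 e.2), cofactorMatAn_smul, neg_one_smul,
    M.normal_eq, cofactorMatAn_smul, cofactorMatAn_smul, ← ha, ← hb,
    cofactorMatAn_congr hvel htan]

theorem continuous_cofactorMatAn' (hX : IsMeshMotion M T m X) (hm : 1 ≤ m) (k : Fin K)
    (n : Fin 2 → ℝ) (t : ℝ) : Continuous fun y => cofactorMatAn (X k) n t y :=
  continuous_matrix fun a b => continuous_cofactorMatAn
    ((hX.smooth k).of_le (by exact_mod_cast hm)) n t a b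

theorem matAn_lineMap (hX : IsMeshMotion M T m X) {t : ℝ} (ht : t ∈ Icc 0 T) (k : Fin K)
    (i : Fin 3) {s : ℝ} (hs : s ∈ Icc (0 : ℝ) 1) :
    matAn (X k) (M.normal k i) t (AffineMap.lineMap (M.edgeStart k i) (M.edgeEnd k i) s) =
      cofactorMatAn (X k) (M.normal k i) t
        (AffineMap.lineMap (M.edgeStart k i) (M.edgeEnd k i) s) :=
  matAn_eq (hX.det_pos k t ht _ (M.lineMap_mem_elem k i hs)).ne' _

/-- The contributions of the numerical flux add up to the penalty term. -/
theorem sum_flux (hX : IsMeshMotion M T m X) (hm : 1 ≤ m) (hT : 0 < T) (τ : ℝ) {t : ℝ}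
    (ht : t ∈ Icc 0 T) {q : Fin K → Plane → Fin 3 → ℝ} (hq : ∀ k, Continuous (q k)) :
    ∑ k, ∑ i, M.edgeIntegral k i (fun x =>
      flux M τ X t q k i x ⬝ᵥ (matAn (X k) (M.normal k i) t x *ᵥ q k x)) =
      τ * jumpTerm M X t q := by
  classical
  set F : Fin K × Fin 3 → ℝ := fun e => M.edgeIntegral e.1 e.2 fun x =>
      flux M τ X t q e.1 e.2 x ⬝ᵥ (matAn (X e.1) (M.normal e.1 e.2) t x *ᵥ q e.1 x) with hF
  set G : Fin K × Fin 3 → ℝ := fun e => M.edgeIntegral e.1 e.2 fun x =>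
      M.jump q e.1 e.2 x ⬝ᵥ (((matAn (X e.1) (M.normal e.1 e.2) t x)ᵀ *
        matAn (X e.1) (M.normal e.1 e.2) t x) *ᵥ M.jump q e.1 e.2 x) with hG
  have hA := fun (e : Fin K × Fin 3) =>
    continuous_cofactorMatAn' hX hm e.1 (M.normal e.1 e.2) t
  have key : ∑ e, F e = ∑ e : Fin K × Fin 3,
      (if M.IsInterior e.1 e.2 then (1 / 2 : ℝ) else 1) * (τ * G e) := by
    refine sum_eq_sum_faces (P := M.SameEdge) M.isInterior_iff (fun e f h => h.symm)
      (fun e f g => TriMesh.SameEdge.unique) ?_ ?_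
    · intro e f h
      have hc : ∀ (B : Plane → Matrix (Fin 3) (Fin 3) ℝ) (u w : Plane → Fin 3 → ℝ),
          Continuous B → Continuous u → Continuous w →
          Continuous fun x => (w x - τ • (B x *ᵥ (w x - u x))) ⬝ᵥ (B x *ᵥ u x) :=
        fun B u w hB hu hw => by
          have h1 : Continuous fun x => w x - u x := hw.sub hu
          have h2 : Continuous fun x => τ • (B x *ᵥ (w x - u x)) :=
            (hB.matrix_mulVec h1).const_smul τ
          have h3 : Continuous fun x => w x - τ • (B x *ᵥ (w x - u x)) := hw.sub h2
          exact h3.dotProduct (hB.matrix_mulVec hu)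
      have h1 : F e = M.edgeIntegral e.1 e.2 fun x =>
          (q f.1 x - τ • (cofactorMatAn (X e.1) (M.normal e.1 e.2) t x *ᵥ (q f.1 x - q e.1 x)))
            ⬝ᵥ (cofactorMatAn (X e.1) (M.normal e.1 e.2) t x *ᵥ q e.1 x) :=
        M.edgeIntegral_congr fun s hs => by
          rw [flux, TriMesh.jump, h.extTrace_eq, matAn_lineMap hX ht _ _ hs]
      have h2 : F f = M.edgeIntegral f.1 f.2 fun x =>
          (q e.1 x - τ • (cofactorMatAn (X f.1) (M.normal f.1 f.2) t x *ᵥ (q e.1 x - q f.1 x)))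
            ⬝ᵥ (cofactorMatAn (X f.1) (M.normal f.1 f.2) t x *ᵥ q f.1 x) :=
        M.edgeIntegral_congr fun s hs => by
          rw [flux, TriMesh.jump, h.symm.extTrace_eq, matAn_lineMap hX ht _ _ hs]
      rw [h1, h2, h.edgeIntegral_eq, ← M.edgeIntegral_add (hc _ _ _ (hA e) (hq e.1) (hq f.1))
        (hc _ _ _ (hA f) (hq f.1) (hq e.1)), hG, ← M.edgeIntegral_const_mul]
      refine M.edgeIntegral_congr fun s hs => ?_
      rw [cofactorMatAn_neighbor hX hm hT h ht hs, TriMesh.jump, h.extTrace_eq,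
        matAn_lineMap hX ht _ _ hs, penalty_flux_add (cofactorMatAn_transpose _ _ _ _)]
    · intro e he
      rw [hF, hG, ← M.edgeIntegral_const_mul]
      refine M.edgeIntegral_congr fun s hs => ?_
      rw [flux, TriMesh.jump, TriMesh.extTrace, dif_neg he]
      exact penalty_flux_boundary τ _
  rw [← Fintype.sum_prod_type' (f := fun k i => F (k, i))]
  refine key.trans ?_
  rw [jumpTerm, Finset.mul_sum, Fintype.sum_prod_type]
  refine Finset.sum_congr rfl fun k _ => ?_
  rw [Finset.mul_sum]
  refine Finset.sum_congr rfl fun i _ => ?_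
  simp only [hG]
  rw [mul_left_comm]

end

section

/-! ### The rate of change of the energy -/

theorem isPoly_slope {n : ℕ} {T t s : ℝ} {f : ℝ → Plane → ℝ}
    (hf : ∀ s ∈ Icc 0 T, IsPoly n (f s)) (ht : t ∈ Icc 0 T) (hs : s ∈ Icc 0 T) :
    IsPoly n fun x => slope (fun r => f r x) t s := by
  simp only [slope, vsub_eq_sub, smul_eq_mul]
  exact ((hf s hs).sub (hf t ht)).const_mul _

theorem neBot_nhdsWithin_Icc_diff {T t : ℝ} (hT : 0 < T) (ht : t ∈ Icc 0 T) :
    (𝓝[Icc 0 T \ {t}] t).NeBot := by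
  have := (uniqueDiffWithinAt_iff_accPt.mp (uniqueDiffOn_Icc hT t ht))
  rwa [accPt_principal_iff_nhdsWithin] at this

theorem eventually_mem_Icc {T t : ℝ} : ∀ᶠ s in 𝓝[Icc 0 T \ {t}] t, s ∈ Icc 0 T :=
  eventually_mem_nhdsWithin.mono fun _ hs => hs.1

/-- The time derivative of a polynomial with moving coefficients is a polynomial. -/
theorem isPoly_of_hasDerivWithinAt {n : ℕ} {T t : ℝ} (hT : 0 < T) (ht : t ∈ Icc 0 T)
    {f : ℝ → Plane → ℝ} {f' : Plane → ℝ} (hf : ∀ s ∈ Icc 0 T, IsPoly n (f s))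
    (h : ∀ x, HasDerivWithinAt (fun s => f s x) (f' x) (Icc 0 T) t) : IsPoly n f' := by
  have := neBot_nhdsWithin_Icc_diff hT ht
  exact IsPoly.of_tendsto (l := 𝓝[Icc 0 T \ {t}] t)
    (eventually_mem_Icc.mono fun s hs => isPoly_slope hf ht hs)
    fun x => hasDerivWithinAt_iff_tendsto_slope.mp (h x)

/-- An exact quotient rule for difference quotients, expressing the slope of `p² / J` through slopes
of polynomials, which are uniformly bounded on an element. -/
theorem slope_sq_div_eq {p J : ℝ → ℝ} {s t : ℝ} (hs : J s ≠ 0) (ht : J t ≠ 0) :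
    slope (fun r => p r / J r * p r) t s =
      (p s + p t) * slope p t s / J s - p t ^ 2 * slope J t s / (J s * J t) := by
  simp only [slope, vsub_eq_sub, smul_eq_mul]
  field_simp
  ring

/-- Dominated convergence for the difference quotients. Differentiability in time is assumed
pointwise in space only; finite dimensionality supplies the uniform bound. -/
theorem hasDerivWithinAt_integral_sq_div {D : Set Plane} (hD : IsCompact D) {n : ℕ} {T t : ℝ}
    (hT : 0 < T) (ht : t ∈ Icc 0 T) {Jmin : ℝ} (hJmin : 0 < Jmin) {p J : ℝ → Plane → ℝ}
    {p' J' : Plane → ℝ} (hp : ∀ s ∈ Icc 0 T, IsPoly n (p s)) (hJ : ∀ s ∈ Icc 0 T, IsPoly n (J s))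
    (hJlow : ∀ s ∈ Icc 0 T, ∀ x ∈ D, Jmin ≤ J s x)
    (hp' : ∀ x, HasDerivWithinAt (fun s => p s x) (p' x) (Icc 0 T) t)
    (hJ' : ∀ x, HasDerivWithinAt (fun s => J s x) (J' x) (Icc 0 T) t) :
    HasDerivWithinAt (fun s => ∫ x in D, p s x / J s x * p s x)
      (∫ x in D, (2 * (p t x / J t x * p' x) - (p t x / J t x) ^ 2 * J' x)) (Icc 0 T) t := by
  have hne := neBot_nhdsWithin_Icc_diff hT ht
  set l := 𝓝[Icc 0 T \ {t}] t with hl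
  have hmem : ∀ᶠ s in l, s ∈ Icc 0 T := eventually_mem_Icc
  have hJpos : ∀ s ∈ Icc 0 T, ∀ x ∈ D, 0 < J s x := fun s hs x hx => hJmin.trans_le (hJlow s hs x hx)
  have hgc : ∀ s ∈ Icc 0 T, ContinuousOn (fun x => p s x / J s x * p s x) D := fun s hs =>
    ((hp s hs).continuous.continuousOn.div (hJ s hs).continuous.continuousOn
      fun x hx => (hJpos s hs x hx).ne').mul (hp s hs).continuous.continuousOn
  obtain ⟨B₁, hB₁⟩ := IsPoly.eventually_bounded (l := l)
    (hmem.mono fun s hs => isPoly_slope hp ht hs)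
    (fun x => hasDerivWithinAt_iff_tendsto_slope.mp (hp' x)) hD
  obtain ⟨B₂, hB₂⟩ := IsPoly.eventually_bounded (l := l)
    (hmem.mono fun s hs => isPoly_slope hJ ht hs)
    (fun x => hasDerivWithinAt_iff_tendsto_slope.mp (hJ' x)) hD
  obtain ⟨B₃, hB₃⟩ := IsPoly.eventually_bounded (l := l) (hmem.mono fun s hs => hp s hs)
    (fun x => ((hp' x).continuousWithinAt.mono_left (nhdsWithin_mono t sdiff_subset))) hD
  obtain ⟨B₄, hB₄⟩ := hD.exists_bound_of_continuousOn (hp t ht).continuous.continuousOn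
  rw [hasDerivWithinAt_iff_tendsto_slope]
  have hslope : ∀ᶠ s in l, ∫ x in D, slope (fun r => p r x / J r x * p r x) t s =
      slope (fun s => ∫ x in D, p s x / J s x * p s x) t s := by
    filter_upwards [hmem] with s hs
    simp only [slope, vsub_eq_sub, smul_eq_mul]
    rw [integral_const_mul, integral_sub ((hgc s hs).integrableOn_compact hD)
      ((hgc t ht).integrableOn_compact hD)]
  refine Tendsto.congr' hslope ?_
  refine tendsto_integral_filter_of_dominated_convergence
    -- The bound read off from `slope_sq_div_eq`: `B₁`, `B₂` bound the slopes of `p` and `J`, and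
    -- `B₃`, `B₄` bound `p` at the times `s` and `t`.
    (fun _ => (B₃ + B₄) * B₁ / Jmin + B₄ ^ 2 * B₂ / (Jmin * Jmin)) ?_ ?_
    (integrableOn_const hD.measure_ne_top) ?_
  · filter_upwards [hmem] with s hs
    have hc : ContinuousOn (fun x => slope (fun r => p r x / J r x * p r x) t s) D := by
      simp only [slope, vsub_eq_sub, smul_eq_mul]
      exact continuousOn_const.mul ((hgc s hs).sub (hgc t ht))
    exact hc.aestronglyMeasurable hD.measurableSet
  · filter_upwards [hmem, hB₁, hB₂, hB₃] with s hs h1 h2 h3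
    filter_upwards [ae_restrict_mem hD.measurableSet] with x hx
    have hJs := hJlow s hs x hx
    have hJt := hJlow t ht x hx
    have hJs0 := hJpos s hs x hx
    have hJt0 := hJpos t ht x hx
    have h4 : |p t x| ≤ B₄ := hB₄ x hx
    have h1 := h1 x hx
    have h2 := h2 x hx
    have h3 := h3 x hx
    have hB₁0 := (abs_nonneg _).trans h1
    have hB₂0 := (abs_nonneg _).trans h2
    have hB₃0 := (abs_nonneg _).trans h3
    have hB₄0 := (abs_nonneg _).trans h4
    rw [slope_sq_div_eq (p := fun r => p r x) (J := fun r => J r x) hJs0.ne' hJt0.ne',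
      Real.norm_eq_abs]
    refine (abs_sub _ _).trans (add_le_add ?_ ?_)
    · rw [abs_div, abs_mul, abs_of_pos hJs0]
      have : |p s x + p t x| ≤ B₃ + B₄ := (abs_add_le _ _).trans (add_le_add h3 h4)
      gcongr
    · rw [abs_div, abs_mul, abs_of_pos (mul_pos hJs0 hJt0), abs_pow]
      gcongr
  · filter_upwards [ae_restrict_mem hD.measurableSet] with x hx
    rw [← hasDerivWithinAt_iff_tendsto_slope]
    have hJt := (hJpos t ht x hx).ne'
    refine (((hp' x).div (hJ' x) hJt).mul (hp' x)).congr_deriv ?_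
    rw [Pi.div_apply]
    field_simp
    ring

/-! ### The scheme tested with its own solution, and the global energy balance. -/

variable {K : ℕ} {M : TriMesh K} {T : ℝ} {X : Fin K → ℝ → Plane → Plane} {N : ℕ}

theorem isCompact_elem (M : TriMesh K) (k : Fin K) : IsCompact (M.elem k) :=
  isCompact_triangle _

theorem dist_le_meshSize (M : TriMesh K) (k : Fin K) {x y : Plane} (hx : x ∈ M.elem k)
    (hy : y ∈ M.elem k) : dist x y ≤ M.meshSize :=
  (Metric.dist_le_diam_of_mem (isCompact_elem M k).isBounded hx hy).trans
    (le_ciSup (f := fun k => Metric.diam (M.elem k)) (finite_range _).bddAbove k)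

/-- The skew-symmetric right-hand side, tested with the solution. -/
theorem schemeRHS_self (hX : IsMeshMotion M T (N + 3) X) (τ : ℝ) {t : ℝ} (ht : t ∈ Icc 0 T)
    {q : Fin K → Plane → Fin 3 → ℝ} (hq : ∀ k, Continuous (q k)) (k : Fin K) :
    schemeRHS M τ X t q k (q k) =
      -(1 / 2) * (∫ x in M.elem k, cofactorDiv (X k) t x * (q k x ⬝ᵥ q k x)) -
        (1 / 2) * ∑ i, M.edgeIntegral k i fun x =>
          flux M τ X t q k i x ⬝ᵥ (matAn (X k) (M.normal k i) t x *ᵥ q k x) := by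
  have hX2 : ContDiff ℝ 2 fun z : ℝ × Plane => X k z.1 z.2 :=
    (hX.smooth k).of_le (by norm_cast; omega)
  have hdet : ∀ x ∈ M.elem k, jacDet (X k) t x ≠ 0 := fun x hx => (hX.det_pos k t ht x hx).ne'
  have hD := isCompact_elem M k
  have hqc : ∀ c, Continuous fun x => q k x c := fun c => (continuous_apply c).comp (hq k)
  have hint : ∀ j, IntegrableOn (fun x => (dmatA (X k) j t x *ᵥ q k x) ⬝ᵥ q k x) (M.elem k) := by
    intro j
    have hc : Continuous fun x => (Matrix.of (fun a b =>
        pderiv j (fun y => cofactorMatA (X k) j t y a b) x) *ᵥ q k x) ⬝ᵥ q k x := by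
      have h1 : Continuous fun x => (Matrix.of (fun a b =>
          pderiv j (fun y => cofactorMatA (X k) j t y a b) x) : Matrix (Fin 3) (Fin 3) ℝ) :=
        continuous_matrix fun a b =>
          (contDiff_pderiv (n := 0) (contDiff_cofactorMatA (n := 1) hX2 j t a b) j).continuous
      exact (h1.matrix_mulVec (hq k)).dotProduct (hq k)
    refine (hc.continuousOn.integrableOn_compact hD).congr_fun ?_ hD.measurableSet
    intro x hx
    have : dmatA (X k) j t x = Matrix.of (fun a b =>
        pderiv j (fun y => cofactorMatA (X k) j t y a b) x) := by
      ext a b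
      exact dmatA_eq hX2 (hdet x hx) j a b
    simp only [this]
  have hsum : ∑ j, ∫ x in M.elem k, (dmatA (X k) j t x *ᵥ q k x) ⬝ᵥ q k x =
      ∫ x in M.elem k, cofactorDiv (X k) t x * (q k x ⬝ᵥ q k x) := by
    rw [← integral_finsetSum _ fun j _ => hint j]
    refine setIntegral_congr_fun hD.measurableSet fun x hx => ?_
    rw [← geomDiv_eq hX2 (hdet x hx), ← sum_dotProduct, ← Matrix.sum_mulVec,
      sum_dmatA hX2 (hdet x hx), Matrix.smul_mulVec, Matrix.one_mulVec, smul_dotProduct,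
      smul_eq_mul]
  rw [schemeRHS, ← hsum]
  congr 1
  rw [Finset.mul_sum]
  refine Finset.sum_congr rfl fun j _ => ?_
  -- With `w = q` the first two volume integrals coincide up to sign, so no integration by parts is
  -- needed.
  simp only [dotProduct_comm (fun c => pderiv j (fun y => (matA (X k) j t y *ᵥ q k y) c) _)]
  ring

theorem exists_energy_estimate (N : ℕ) (Jmin Jmax G R : ℝ) (hJmin : 0 < Jmin) :
    ∃ C : ℝ, 0 ≤ C ∧ ∀ (K : ℕ) (M : TriMesh K) (T τ : ℝ) (_ : 0 < T)
      (X : Fin K → ℝ → Plane → Plane) (J : Fin K → ℝ → Plane → ℝ)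
      (qJ q : Fin K → ℝ → Plane → Fin 3 → ℝ) (_ : IsMeshMotion M T (N + 3) X)
      (_ : IsWADGSolution M N T τ X J qJ q)
      (_ : ∀ k, ∀ t ∈ Icc 0 T, ∀ x ∈ M.elem k, Jmin ≤ J k t x)
      (_ : ∀ t ∈ Icc 0 T, DerivBound M (N + 1) Jmax (fun k => J k t))
      (_ : ∀ t ∈ Icc 0 T, DerivBound M (N + 1) G (fun k => geomDiv (X k) t))
      (_ : ∀ t ∈ Icc 0 T, brokenSobolevSq M (N + 1) (fun k => q k t) ≤ R ^ 2),
      ∀ t ∈ Icc 0 T, ∃ E' : ℝ,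
        HasDerivWithinAt (fun s => energy M (fun k => J k s) (fun k => qJ k s)) E' (Icc 0 T) t ∧
        E' ≤ C * M.meshSize ^ (2 * N + 2) - τ * ((1 / 2) * jumpTerm M X t (fun k => q k t)) := by
  -- `|G|` makes the constant nonnegative whatever the sign of `G`.
  obtain ⟨C, hC, hest⟩ := exists_element_estimate N (Jmax := Jmax) hJmin (abs_nonneg G)
  refine ⟨(1 / 2) * (C * R ^ 2), by positivity, ?_⟩
  intro K M T τ hT X J qJ q hX hsol hJlow hJreg hGreg hqreg t ht
  set p' : Fin K → Plane → Fin 3 → ℝ :=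
    fun k x c => derivWithin (fun s => qJ k s x c) (Icc 0 T) t with hp'def
  set J' : Fin K → Plane → ℝ := fun k x => derivWithin (fun s => J k s x) (Icc 0 T) t with hJ'def
  have hp' : ∀ k c x, HasDerivWithinAt (fun s => qJ k s x c) (p' k x c) (Icc 0 T) t :=
    fun k c x => (hsol.qJ_diff k x c t ht).hasDerivWithinAt
  have hJ' : ∀ k x, HasDerivWithinAt (fun s => J k s x) (J' k x) (Icc 0 T) t :=
    fun k x => (hsol.J_diff k x t ht).hasDerivWithinAt
  have hp'p : ∀ k c, IsPoly N fun x => p' k x c := fun k c =>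
    isPoly_of_hasDerivWithinAt hT ht (fun s hs => hsol.qJ_poly k s hs c) (hp' k c)
  have hJ'p : ∀ k, IsPoly N (J' k) := fun k =>
    isPoly_of_hasDerivWithinAt hT ht (fun s hs => hsol.J_poly k s hs) (hJ' k)
  have hqc : ∀ k, Continuous (q k t) := fun k =>
    continuous_pi fun c => (hsol.q_poly k t ht c).continuous
  have hX2 : ∀ k, ContDiff ℝ 2 fun z : ℝ × Plane => X k z.1 z.2 := fun k =>
    (hX.smooth k).of_le (by norm_cast; omega)
  have hdet : ∀ k, ∀ x ∈ M.elem k, jacDet (X k) t x ≠ 0 := fun k x hx =>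
    (hX.det_pos k t ht x hx).ne'
  have hdc : ∀ k, ContDiff ℝ (N + 1 : ℕ) (cofactorDiv (X k) t) := fun k =>
    contDiff_cofactorDiv (hX.smooth k) t
  refine ⟨(1 / 2) * ∑ c, ∑ k, ∫ x in M.elem k, (2 * (qJ k t x c / J k t x * p' k x c) -
    (qJ k t x c / J k t x) ^ 2 * J' k x), ?_, ?_⟩
  · unfold energy
    refine HasDerivWithinAt.const_mul _ (HasDerivWithinAt.fun_sum fun c _ =>
      HasDerivWithinAt.fun_sum fun k _ => ?_)
    exact hasDerivWithinAt_integral_sq_div (isCompact_elem M k) hT ht hJmin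
      (fun s hs => hsol.qJ_poly k s hs c) (hsol.J_poly k) (hJlow k) (hp' k c) (hJ' k)
  have hyc : ∀ k c, ContinuousOn (fun x => qJ k t x c / J k t x) (M.elem k) := fun k c =>
    (hsol.qJ_poly k t ht c).continuous.continuousOn.div (hsol.J_poly k t ht).continuous.continuousOn
      fun x hx => (hsol.J_pos k t ht x hx).ne'
  -- The exact energy balance on one element: twice its rate is the consistency error minus the
  -- boundary flux.
  have helem : ∀ k, ∑ c, ∫ x in M.elem k, (2 * (qJ k t x c / J k t x * p' k x c) -
      (qJ k t x c / J k t x) ^ 2 * J' k x) =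
      ∑ c, (∫ x in M.elem k, ((qJ k t x c / J k t x) ^ 2 * -J' k x -
        cofactorDiv (X k) t x * q k t x c ^ 2)) -
      ∑ i, M.edgeIntegral k i fun x => flux M τ X t (fun l => q l t) k i x ⬝ᵥ
        (matAn (X k) (M.normal k i) t x *ᵥ q k t x) := by
    intro k
    have hD := isCompact_elem M k
    have hpc := fun c => (hp'p k c).continuous.continuousOn (s := M.elem k)
    have hqcc := fun c => (hsol.q_poly k t ht c).continuous.continuousOn (s := M.elem k)
    have hJc := (hJ'p k).continuous.continuousOn (s := M.elem k)
    have i1 : ∀ c, IntegrableOn (fun x => qJ k t x c / J k t x * p' k x c) (M.elem k) := fun c =>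
      ((hyc k c).mul (hpc c)).integrableOn_compact hD
    have i2 : ∀ c, IntegrableOn (fun x => (qJ k t x c / J k t x) ^ 2 * J' k x) (M.elem k) :=
      fun c => (((hyc k c).pow 2).mul hJc).integrableOn_compact hD
    have i3 : ∀ c, IntegrableOn (fun x => (qJ k t x c / J k t x) ^ 2 * -J' k x) (M.elem k) :=
      fun c => (((hyc k c).pow 2).mul hJc.neg).integrableOn_compact hD
    have i4 : ∀ c, IntegrableOn (fun x => cofactorDiv (X k) t x * q k t x c ^ 2) (M.elem k) :=
      fun c => ((hdc k).continuous.continuousOn.mul ((hqcc c).pow 2)).integrableOn_compact hD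
    have i5 : ∀ c, IntegrableOn (fun x => p' k x c * q k t x c) (M.elem k) :=
      fun c => ((hpc c).mul (hqcc c)).integrableOn_compact hD
    have hwave : ∑ c, ∫ x in M.elem k, qJ k t x c / J k t x * p' k x c =
        schemeRHS M τ X t (fun l => q l t) k (q k t) := by
      rw [← hsol.wave k t ht (q k t) (hsol.q_poly k t ht)]
      simp only [dotProduct]
      rw [integral_finsetSum _ fun c _ => i5 c]
      refine Finset.sum_congr rfl fun c _ => ?_
      -- The time derivative of `qJ` is itself an admissible test polynomial, so the projection
      -- exchanges `qJ / J` for `q`.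
      rw [← hsol.wadg k t ht c _ (hp'p k c)]
      simp only [mul_comm (q k t _ c), hp'def]
    have hdiv : ∫ x in M.elem k, cofactorDiv (X k) t x * (q k t x ⬝ᵥ q k t x) =
        ∑ c, ∫ x in M.elem k, cofactorDiv (X k) t x * q k t x c ^ 2 := by
      rw [← integral_finsetSum _ fun c _ => i4 c]
      simp only [dotProduct, Finset.mul_sum, sq]
    rw [schemeRHS_self hX τ ht hqc k, hdiv] at hwave
    have h1 : ∀ c, ∫ x in M.elem k, (2 * (qJ k t x c / J k t x * p' k x c) -
        (qJ k t x c / J k t x) ^ 2 * J' k x) =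
        2 * (∫ x in M.elem k, qJ k t x c / J k t x * p' k x c) +
          ∫ x in M.elem k, (qJ k t x c / J k t x) ^ 2 * -J' k x := by
      intro c
      rw [integral_sub ((i1 c).const_mul 2) (i2 c), integral_const_mul, sub_eq_add_neg]
      simp only [mul_neg, integral_neg]
    have h2 : ∀ c, ∫ x in M.elem k, ((qJ k t x c / J k t x) ^ 2 * -J' k x -
        cofactorDiv (X k) t x * q k t x c ^ 2) =
        (∫ x in M.elem k, (qJ k t x c / J k t x) ^ 2 * -J' k x) -
          ∫ x in M.elem k, cofactorDiv (X k) t x * q k t x c ^ 2 := fun c =>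
      integral_sub (i3 c) (i4 c)
    simp only [h1, h2, Finset.sum_add_distrib, Finset.sum_sub_distrib, ← Finset.mul_sum, hwave]
    ring
  have hbound : ∀ k c, ∫ x in M.elem k, ((qJ k t x c / J k t x) ^ 2 * -J' k x -
      cofactorDiv (X k) t x * q k t x c ^ 2) ≤ C * M.meshSize ^ (2 * N + 2) *
        ∑ r ∈ Finset.range (N + 1 + 1),
          ∫ x in M.elem k, ‖iteratedFDeriv ℝ r (fun y => q k t y c) x‖ ^ 2 := by
    intro k c
    refine (le_abs_self _).trans (hest (M.vert k) (M.indep k) M.meshSize (fun x => qJ k t x c)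
      (fun x => q k t x c) (J k t) (cofactorDiv (X k) t) (fun x => -J' k x)
      (fun x hx y hy => dist_le_meshSize M k hx hy) (hsol.qJ_poly k t ht c)
      (hsol.q_poly k t ht c) (hJ'p k).neg (hsol.J_poly k t ht).contDiff (hdc k) (hJlow k t ht)
      (hJreg t ht k) ?_ (hsol.wadg k t ht c) ?_)
    · intro x hx r hr
      rw [← ((geomDiv_eventuallyEq (hX2 k) (hdet k x hx)).iteratedFDeriv ℝ r).eq_of_nhds]
      exact (hGreg t ht k x hx r hr).trans (le_abs_self G)
    · intro θ hθ
      simp only [neg_mul]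
      rw [integral_neg]
      -- The discrete geometric conservation law says that `-J'` is the `L²` projection of the
      -- geometric divergence.
      refine (neg_eq_iff_eq_neg.mpr (hsol.gcl k t ht θ hθ)).trans ?_
      exact setIntegral_congr_fun (isCompact_elem M k).measurableSet fun x hx => by
        simp only [geomDiv_eq (hX2 k) (hdet k x hx)]
  have hh : 0 ≤ M.meshSize := Real.iSup_nonneg fun k => Metric.diam_nonneg
  rw [Finset.sum_comm]
  simp only [helem]
  rw [Finset.sum_sub_distrib, sum_flux hX (by omega) hT τ ht hqc]
  have htot : ∑ k, ∑ c, ∫ x in M.elem k, ((qJ k t x c / J k t x) ^ 2 * -J' k x -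
      cofactorDiv (X k) t x * q k t x c ^ 2) ≤ C * M.meshSize ^ (2 * N + 2) * R ^ 2 := by
    refine (Finset.sum_le_sum fun k _ => Finset.sum_le_sum fun c _ => hbound k c).trans ?_
    simp only [← Finset.mul_sum]
    exact mul_le_mul_of_nonneg_left (hqreg t ht) (by positivity)
  linarith

end

end ALEDG

theorem theorem5 (N : ℕ) (Jmin Jmax G R : ℝ) (hJmin : 0 < Jmin) :
    ∃ C : ℝ, 0 ≤ C ∧
      ∀ (K : ℕ) (M : ALEDG.TriMesh K) (T τ : ℝ) (_hT : 0 < T) (_hτ : 0 ≤ τ)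
        (X : Fin K → ℝ → ALEDG.Plane → ALEDG.Plane)
        (J : Fin K → ℝ → ALEDG.Plane → ℝ)
        (qJ q : Fin K → ℝ → ALEDG.Plane → Fin 3 → ℝ)
        (_hX : ALEDG.IsMeshMotion M T (N + 3) X)
        (_hsol : ALEDG.IsWADGSolution M N T τ X J qJ q)
        (_hJlow : ∀ k, ∀ t ∈ Set.Icc 0 T, ∀ x ∈ M.elem k, Jmin ≤ J k t x)
        (_hJreg : ∀ t ∈ Set.Icc 0 T, ALEDG.DerivBound M (N + 1) Jmax (fun k => J k t))
        (_hGreg : ∀ t ∈ Set.Icc 0 T,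
          ALEDG.DerivBound M (N + 1) G (fun k => ALEDG.geomDiv (X k) t))
        (_hqreg : ∀ t ∈ Set.Icc 0 T,
          ALEDG.brokenSobolevSq M (N + 1) (fun k => q k t) ≤ R ^ 2),
        ∀ t ∈ Set.Icc 0 T, ∃ E' : ℝ,
          HasDerivWithinAt (fun s => ALEDG.energy M (fun k => J k s) (fun k => qJ k s)) E'
            (Set.Icc 0 T) t ∧
          E' ≤ C * M.meshSize ^ (2 * N + 2)
            - τ * ((1 / 2) * ALEDG.jumpTerm M X t (fun k => q k t)) := by
  obtain ⟨C, hC, h⟩ := ALEDG.exists_energy_estimate N Jmin Jmax G R hJmin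
  exact ⟨C, hC, fun K M T τ hT _ X J qJ q hX hsol hJlow hJreg hGreg hqreg =>
    h K M T τ hT X J qJ q hX hsol hJlow hJreg hGreg hqreg⟩
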